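/- Let $\wedge\{\Theta_n,\Xi_n\}$ be the exterior algebra over $\mathbb{C}$ on the $2n$ symbols $\theta_1,\dots,\theta_n,\xi_1,\dots,\xi_n$, and let $\theta_j\odot(-)$ denote left contraction: for distinct generators $\omega_1,\dots,\omega_r$, $\theta_j\odot(\omega_1\cdots\omega_r)$ equals $(-1)^{s-1}\omega_1\cdots\widehat{\omega_s}\cdots\omega_r$ if $\omega_s=\theta_j$, and $0$ if $\theta_j$ is not among them. For nonempty $B\subseteq[n]=\{1,\dots,n\}$ let $\rho_B(f)=\sum_{i,j\in B,\,i\neq j}\xi_i\cdot(\theta_j\odot f)$ if $|B|>1$, and $\rho_B(f)=\xi_i\cdot(\theta_i\odot f)$ if $B=\{i\}$; these operators commute. For a set partition $\pi=\{B_1/\cdots/B_k\}$ of $[n]$ put $F_\pi=(\rho_{B_1}\circ\cdots\circ\rho_{B_k})(\theta_1\theta_2\cdots\theta_n)$. Let $\Pi(n)$ be the set of all set partitions of $[n]$ and $\mathrm{NC}(n)$ the subset of noncrossing ones. The crossing resolution is the linear map $p:\mathbb{C}[\Pi(n)]\to\mathbb{C}[\mathrm{NC}(n)]$ with $p(\pi)=\sum_{\mu\in\mathrm{NC}(n)}c_{\pi,\mu}\,\mu$,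 where the $c_{\pi,\mu}\in\mathbb{C}$ are the unique coefficients with $F_\pi=\sum_{\mu\in\mathrm{NC}(n)}c_{\pi,\mu}F_\mu$. **Proposition 6.2.** Let $\pi=\{A/B\}\in\Pi(n)$ be a two-block set partition with $|A|,|B|\geq 2$. Then $A$ and $B$ decompose as $A=A_1\sqcup\cdots\sqcup A_m$ and $B=B_1\sqcup\cdots\sqcup B_m$ into maximal nonempty cyclic intervals of the cycle $(1,2,\dots,n)$ such that $(A_1,B_1,A_2,B_2,\dots,A_m,B_m)$ is cyclically sequential (each set begins right after the end of the preceding one, and $A_1$ comes right after $B_m$). For every such decomposition, $$p(\pi)=\sum_{\{S/T\}}\epsilon(S,T)\cdot\{S/T\},$$ where the sum is over all two-block noncrossing set partitions $\{S/T\}\in\mathrm{NC}(n)$, and - $\epsilon(S,T)=0$ if $|S|<2$ or $|T|<2$; - $\epsilon(S,T)=+1$ if $|S|,|T|\geq2$ and $S,T$ are both unions of an odd number of the sets $A_1,B_1,\dots,A_m,B_m$; - $\epsilon(S,T)=-1$ if $|S|,|T|\geq2$ and $S,T$ are both unions of an even number of these sets; - $\epsilon(S,T)=0$ if $S,T$ are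 not unions of these sets. -/

import Mathlib

open Finset

/-- Set partitions of `[n]`, the ground set being `Fin n`. -/
abbrev SetPartition (n : ℕ) : Type := Finpartition (Finset.univ : Finset (Fin n))

/-- `π` is noncrossing: whenever `a < b < c < d`, `a ∼ c` and `b ∼ d`, all four indices are in
the same block. -/
def SetPartition.IsNoncrossing {n : ℕ} (π : SetPartition n) : Prop :=
  ∀ a b c d : Fin n, a < b → b < c → c < d →
    π.part a = π.part c → π.part b = π.part d → π.part a = π.part b

/-- The noncrossing set partitions of `[n]`. -/
abbrev NC (n : ℕ) : Type := {π : SetPartition n // π.IsNoncrossing}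

noncomputable instance NC.instFintype (n : ℕ) : Fintype (NC n) := Fintype.ofFinite _

namespace Fermion

/-- The exterior algebra over `ℂ` on the `2n` symbols `θ₁, …, θₙ, ξ₁, …, ξₙ`; the left summand
indexes the `θ`'s, the right one the `ξ`'s. -/
abbrev Alg (n : ℕ) : Type := ExteriorAlgebra ℂ (Fin n ⊕ Fin n → ℂ)

/-- The generator `θ_i`. -/
noncomputable def theta {n : ℕ} (i : Fin n) : Alg n :=
  ExteriorAlgebra.ι ℂ (Pi.single (Sum.inl i) 1)

/-- The generator `ξ_i`. -/
noncomputable def xi {n : ℕ} (i : Fin n) : Alg n :=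
  ExteriorAlgebra.ι ℂ (Pi.single (Sum.inr i) 1)

/-- The exterior differentiation `f ↦ θ_j ⊙ f`, i.e. the left contraction by the coordinate
functional dual to `θ_j`: it sends `ω₁ ⋯ ω_r` to `(-1)^(s-1) ω₁ ⋯ ω̂_s ⋯ ω_r` if `ω_s = θ_j`, and to
`0` if `θ_j` does not occur, for distinct generators `ω₁, …, ω_r`. -/
noncomputable def dTheta {n : ℕ} (j : Fin n) : Module.End ℂ (Alg n) :=
  CliffordAlgebra.contractLeft (Q := (0 : QuadraticForm ℂ (Fin n ⊕ Fin n → ℂ)))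
    (LinearMap.proj (Sum.inl j))

/-- The operator `f ↦ ξ_i · (θ_j ⊙ f)`. -/
noncomputable def polar {n : ℕ} (i j : Fin n) : Module.End ℂ (Alg n) :=
  LinearMap.mulLeft ℂ (xi i) ∘ₗ dTheta j

/-- The block operator `ρ_B`: the sum of the operators `f ↦ ξ_i · (θ_j ⊙ f)` over `i ≠ j` in `B`
if `|B| > 1`, and the operator `f ↦ ξ_i · (θ_i ⊙ f)` if `B = {i}`. -/
noncomputable def blockOp {n : ℕ} (B : Finset (Fin n)) : Module.End ℂ (Alg n) :=
  if 1 < #B then ∑ q ∈ B.offDiag, polar q.1 q.2 else ∑ i ∈ B, polar i i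

theorem dTheta_xi_mul {n : ℕ} (i j : Fin n) (f : Alg n) :
    dTheta j (xi i * f) = -(xi i * dTheta j f) := by
  have h := CliffordAlgebra.contractLeft_ι_mul
    (Q := (0 : QuadraticForm ℂ (Fin n ⊕ Fin n → ℂ))) (LinearMap.proj (Sum.inl j))
    (Pi.single (Sum.inr i) 1) f
  simpa [dTheta, xi, ExteriorAlgebra.ι] using h

theorem dTheta_comm {n : ℕ} (i j : Fin n) (f : Alg n) :
    dTheta i (dTheta j f) = -dTheta j (dTheta i f) :=
  CliffordAlgebra.contractLeft_comm _ _ f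

theorem xi_mul_comm {n : ℕ} (i j : Fin n) : (xi i * xi j : Alg n) = -(xi j * xi i) :=
  eq_neg_of_add_eq_zero_left (ExteriorAlgebra.ι_add_mul_swap _ _)

theorem polar_commute {n : ℕ} (a b c d : Fin n) : Commute (polar a b) (polar c d) := by
  refine LinearMap.ext fun f => ?_
  simp only [polar, Module.End.mul_apply, LinearMap.comp_apply, LinearMap.mulLeft_apply,
    dTheta_xi_mul, mul_neg, ← mul_assoc]
  rw [xi_mul_comm a c, dTheta_comm b d]
  simp

/-- Block operators commute, so that their composition over the blocks of a set partition does
not depend on an order. -/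
theorem blockOp_commute {n : ℕ} (A B : Finset (Fin n)) : Commute (blockOp A) (blockOp B) := by
  unfold blockOp
  split_ifs <;>
    exact Commute.sum_left _ _ _ fun _ _ => Commute.sum_right _ _ _ fun _ _ => polar_commute ..

/-- The fermion `F_π = (ρ_{B₁} ∘ ⋯ ∘ ρ_{B_k}) (θ₁ θ₂ ⋯ θₙ)`, where `B₁, …, B_k` are the blocks
of `π`. -/
noncomputable def F {n : ℕ} (π : SetPartition n) : Alg n :=
  π.parts.noncommProd blockOp (fun A _ B _ _ => blockOp_commute A B) (List.ofFn theta).prod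

end Fermion

open Classical in
/-- The coefficients `c_{π,μ}` of the expansion `F_π = ∑_{μ ∈ NC(n)} c_{π,μ} F_μ`. (The default
value `0` is there only because the definition does not prove that this expansion exists and is
unique.) -/
noncomputable def resolutionCoeff {n : ℕ} (π : SetPartition n) : NC n → ℂ :=
  if h : ∃! c : NC n → ℂ, Fermion.F π = ∑ μ : NC n, c μ • Fermion.F μ.1 then h.choose else 0

/-- The crossing resolution: the linear map `p : ℂ[Π(n)] → ℂ[NC(n)]` that sends `π` to
`∑_{μ ∈ NC(n)} c_{π,μ} · μ`. -/
noncomputable def crossingResolution (n : ℕ) : (SetPartition n →₀ ℂ) →ₗ[ℂ] (NC n →₀ ℂ) :=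
  Finsupp.linearCombination ℂ fun π : SetPartition n =>
    ∑ μ : NC n, Finsupp.single μ (resolutionCoeff π μ)

/-- The closed cyclic interval `[i, j]_n` from `i` to `j` in the cycle `(1, 2, …, n)`. -/
def cyclicIcc {n : ℕ} (i j : Fin n) : Finset (Fin n) :=
  if i ≤ j then univ.filter (fun x => i ≤ x ∧ x ≤ j) else univ.filter (fun x => i ≤ x ∨ x ≤ j)

/-- Nonempty cyclic intervals of `(1, 2, …, n)`. -/
def IsCyclicInterval {n : ℕ} (I : Finset (Fin n)) : Prop :=
  ∃ i j : Fin n, I = cyclicIcc i j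

/-- The sequence `(A₁, B₁, A₂, B₂, …, A_m, B_m)` is cyclically sequential: it consists of cyclic
intervals each of which begins right after the end of the preceding one in the cycle
`(1, 2, …, n)`, where `A₁` comes after `B_m`. (`finRotate k` is the cyclic successor `i ↦ i + 1`
on `Fin k`.) -/
def CyclicallySequential {n m : ℕ} (As Bs : Fin m → Finset (Fin n)) : Prop :=
  ∃ a a' b b' : Fin m → Fin n,
    (∀ i, As i = cyclicIcc (a i) (a' i)) ∧
    (∀ i, Bs i = cyclicIcc (b i) (b' i)) ∧
    (∀ i, b i = finRotate n (a' i)) ∧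
    (∀ i, a (finRotate m i) = finRotate n (b' i))

/-- `A = A₁ ⊔ ⋯ ⊔ A_m` and `B = B₁ ⊔ ⋯ ⊔ B_m` are the decompositions of `A` and `B` into maximal
nonempty cyclic intervals, numbered so that `(A₁, B₁, …, A_m, B_m)` is cyclically sequential. -/
structure IsCyclicDecomposition {n m : ℕ} (A B : Finset (Fin n))
    (As Bs : Fin m → Finset (Fin n)) : Prop where
  maximal_left : ∀ i, Maximal (fun I => IsCyclicInterval I ∧ I ⊆ A) (As i)
  maximal_right : ∀ i, Maximal (fun I => IsCyclicInterval I ∧ I ⊆ B) (Bs i)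
  disjoint_left : ∀ i j, i ≠ j → Disjoint (As i) (As j)
  disjoint_right : ∀ i j, i ≠ j → Disjoint (Bs i) (Bs j)
  union_left : univ.biUnion As = A
  union_right : univ.biUnion Bs = B
  sequential : CyclicallySequential As Bs

/-- `S` is the union of `k` of the sets `(A₁, B₁, …, A_m, B_m)`, for some `k` with `par k`. -/
def IsUnionOfPieces {n m : ℕ} (As Bs : Fin m → Finset (Fin n)) (par : ℕ → Prop)
    (S : Finset (Fin n)) : Prop :=
  ∃ P : Finset (Fin m ⊕ Fin m), par #P ∧ S = P.biUnion (Sum.elim As Bs)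

open Classical in
/-- The coefficient `ε(S, T)` of the set partition `μ = {S / T}`: it is `0` if `|S| < 2` or
`|T| < 2`; otherwise it is `1` if both `S` and `T` are unions of an odd number of the sets
`(A₁, B₁, …, A_m, B_m)`, it is `-1` if both are unions of an even number of them, and `0` if `S`
and `T` are not unions of these sets. -/
noncomputable def resolutionSign {n m : ℕ} (As Bs : Fin m → Finset (Fin n))
    (μ : SetPartition n) : ℂ :=
  if ∃ S ∈ μ.parts, #S < 2 then 0
  else if ∀ S ∈ μ.parts, IsUnionOfPieces As Bs Odd S then 1
  else if ∀ S ∈ μ.parts, IsUnionOfPieces As Bs Even S then -1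
  else 0

/-! A block with at least two elements acts by `pairOp`, so `F π` is obtained from the operator
`pairOp A * pairOp Aᶜ`. The heart of the proof is that this operator depends linearly on the cut
function of `A`, that is, on the 0/1 function telling whether `x` and `y` lie on different sides of
`A` (`pairOp_mul_pairOp_compl`). Indeed the product of two polarizations is antisymmetric in the two
`ξ`-indices and in the two `θ`-indices, and antisymmetrizing the coefficients leaves only quadratic
terms in the indicator of `A`.

It remains to decompose cut functions. Let `d = incr A` be the cyclic increment of the indicator of
`A`, whose total sum is zero. The cut of `A` is the sum over `i < j` of `-(d i * d j)` times the cut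
of the interval `Ioc i j` (`cut_eq_sum_cut_Ioc`). The pairs `{Ioc i j, (Ioc i j)ᶜ}` are exactly the
two-block noncrossing partitions. Terms with a singleton side vanish, because `pairOp` of a
singleton is zero.

The coefficient `-(d i * d j)` is nonzero exactly when `A` changes sides right after `i` and right
after `j`, which means that `Ioc i j` and its complement are unions of pieces. Every piece contains
one such break, its last element, so the number of pieces is the number of breaks; a telescoping sum
mod 2 shows that it is even exactly when `d i = d j` (`resolutionSign_eq`).

The coefficients found are the ones defining `p` because the noncrossing fermions are linearly
independent: the monomial given by block minima and block maxima serves as a leading term, and it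
determines a noncrossing partition (`linearIndependent_F_noncrossing`). -/

namespace Fermion

/-! ### Monomials and contractions in the exterior algebra. -/

/-- The generator of the exterior algebra attached to a symbol. -/
noncomputable def gen {n : ℕ} (x : Fin n ⊕ Fin n) : Alg n :=
  ExteriorAlgebra.ι ℂ (Pi.single x 1)

/-- Left contraction by the coordinate functional dual to a symbol. -/
noncomputable def contr {n : ℕ} (x : Fin n ⊕ Fin n) : Module.End ℂ (Alg n) :=
  CliffordAlgebra.contractLeft (Q := (0 : QuadraticForm ℂ (Fin n ⊕ Fin n → ℂ)))
    (LinearMap.proj x)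

theorem contr_gen_mul {n : ℕ} (x y : Fin n ⊕ Fin n) (f : Alg n) :
    contr x (gen y * f) = (if x = y then f else 0) - gen y * contr x f := by
  have h := CliffordAlgebra.contractLeft_ι_mul
    (Q := (0 : QuadraticForm ℂ (Fin n ⊕ Fin n → ℂ))) (LinearMap.proj x) (Pi.single y 1) f
  refine h.trans ?_
  congr 1
  by_cases hxy : x = y <;> simp [hxy]

theorem contr_prod_of_notMem {n : ℕ} (x : Fin n ⊕ Fin n) (l : List (Fin n ⊕ Fin n))
    (hx : x ∉ l) : contr x (l.map gen).prod = 0 := by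
  induction l with
  | nil => simp only [List.map_nil, List.prod_nil]; exact CliffordAlgebra.contractLeft_one _ _
  | cons y l ih =>
    simp only [List.mem_cons, not_or] at hx
    rw [List.map_cons, List.prod_cons, contr_gen_mul, if_neg hx.1, ih hx.2]
    simp

theorem contr_prod_of_mem {n : ℕ} (x : Fin n ⊕ Fin n) (l : List (Fin n ⊕ Fin n))
    (hl : l.Nodup) (hx : x ∈ l) :
    contr x (l.map gen).prod = ((l.filter (· ≠ x)).map gen).prod ∨
      contr x (l.map gen).prod = -((l.filter (· ≠ x)).map gen).prod := by
  induction l with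
  | nil => simp at hx
  | cons y l ih =>
    rw [List.nodup_cons] at hl
    rw [List.map_cons, List.prod_cons, contr_gen_mul]
    by_cases hxy : x = y
    · subst hxy
      left
      have hf : l.filter (· ≠ x) = l :=
        List.filter_eq_self.2 fun z hz => decide_eq_true (by rintro rfl; exact hl.1 hz)
      rw [List.filter_cons_of_neg (by simp), hf, contr_prod_of_notMem x l hl.1]
      simp
    · have hxl : x ∈ l := by simpa [hxy] using hx
      rw [if_neg hxy, List.filter_cons_of_pos (by simpa using Ne.symm hxy), List.map_cons,
        List.prod_cons]
      rcases ih hl.2 hxl with h | h <;> rw [h] <;> simp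

/-- `m` is, up to sign, a product of the generators in `K`, each taken once. -/
def IsMono {n : ℕ} (K : Finset (Fin n ⊕ Fin n)) (m : Alg n) : Prop :=
  ∃ l : List (Fin n ⊕ Fin n), l.Nodup ∧ l.toFinset = K ∧
    (m = (l.map gen).prod ∨ m = -(l.map gen).prod)

theorem IsMono.gen_mul {n : ℕ} {K : Finset (Fin n ⊕ Fin n)} {m : Alg n} (h : IsMono K m)
    {x : Fin n ⊕ Fin n} (hx : x ∉ K) : IsMono (insert x K) (gen x * m) := by
  obtain ⟨l, hl, rfl, h⟩ := h
  refine ⟨x :: l, List.nodup_cons.2 ⟨by simpa using hx, hl⟩, by simp, ?_⟩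
  rcases h with rfl | rfl <;> simp

theorem IsMono.contr {n : ℕ} {K : Finset (Fin n ⊕ Fin n)} {m : Alg n} (h : IsMono K m)
    {x : Fin n ⊕ Fin n} (hx : x ∈ K) : IsMono (K.erase x) (contr x m) := by
  obtain ⟨l, hl, rfl, h⟩ := h
  refine ⟨l.filter (· ≠ x), hl.filter _, ?_, ?_⟩
  · ext y; simp [and_comm]
  · rcases contr_prod_of_mem x l hl (by simpa using hx) with h' | h' <;>
      rcases h with rfl | rfl <;> simp [h']

theorem IsMono.contr_eq_zero {n : ℕ} {K : Finset (Fin n ⊕ Fin n)} {m : Alg n} (h : IsMono K m)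
    {x : Fin n ⊕ Fin n} (hx : x ∉ K) : Fermion.contr x m = 0 := by
  obtain ⟨l, hl, rfl, h⟩ := h
  have := contr_prod_of_notMem x l (by simpa using hx)
  rcases h with rfl | rfl <;> simp [this]

/-- The functional that extracts, up to sign, the coefficient of the monomial with support `K`. -/
noncomputable def coeff {n : ℕ} (K : Finset (Fin n ⊕ Fin n)) : Alg n →ₗ[ℂ] ℂ :=
  (ExteriorAlgebra.algebraMapInv (R := ℂ) (M := Fin n ⊕ Fin n → ℂ)).toLinearMap ∘ₗ
    (K.toList.map contr).prod

theorem IsMono.contr_list {n : ℕ} (l : List (Fin n ⊕ Fin n)) (hl : l.Nodup)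
    {K : Finset (Fin n ⊕ Fin n)} {m : Alg n} (h : IsMono K m) :
    (l.toFinset ⊆ K ∧ IsMono (K \ l.toFinset) ((l.map Fermion.contr).prod m)) ∨
      (¬ l.toFinset ⊆ K ∧ (l.map Fermion.contr).prod m = 0) := by
  induction l with
  | nil => left; simpa using h
  | cons x l ih =>
    rw [List.nodup_cons] at hl
    rw [List.map_cons, List.prod_cons, Module.End.mul_apply, List.toFinset_cons,
      Finset.insert_subset_iff]
    rcases ih hl.2 with ⟨h1, h2⟩ | ⟨h1, h2⟩
    · by_cases hx : x ∈ K
      · left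
        refine ⟨⟨hx, h1⟩, ?_⟩
        have := h2.contr (x := x) (by simp [hx, hl.1])
        convert this using 1
        ext y; simp; tauto
      · right
        exact ⟨fun h => hx h.1, h2.contr_eq_zero (by simp [hx])⟩
    · right
      exact ⟨fun h => h1 h.2, by rw [h2, map_zero]⟩

/-- Contracting by all symbols of `K` kills a monomial that lacks one of them, and the scalar part
kills whatever has symbols left over. Signs are never tracked: independence only needs to know which
coefficients vanish. -/
theorem IsMono.coeff_ne_zero_iff {n : ℕ} {K L : Finset (Fin n ⊕ Fin n)} {m : Alg n}
    (h : IsMono L m) : coeff K m ≠ 0 ↔ L = K := by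
  rw [coeff, LinearMap.comp_apply]
  rcases IsMono.contr_list K.toList K.nodup_toList h with ⟨h1, h2⟩ | ⟨h1, h2⟩
  · rw [Finset.toList_toFinset] at h1 h2
    obtain ⟨l, hl, hlK, h3⟩ := h2
    cases l with
    | nil =>
      have : L = K := by
        refine Finset.Subset.antisymm ?_ h1
        rw [← Finset.sdiff_eq_empty_iff_subset, ← hlK]; simp
      simp only [this, iff_true]
      rcases h3 with h3 | h3 <;> rw [h3] <;> simp
    | cons x l =>
      have hne : L ≠ K := by
        rintro rfl
        simp at hlK
      simp only [hne, iff_false, not_not]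
      have hx : ExteriorAlgebra.algebraMapInv (gen x : Alg n) = 0 := by
        simp [gen, ExteriorAlgebra.algebraMapInv]
      rcases h3 with h3 | h3 <;> rw [h3] <;> simp [hx]
  · rw [Finset.toList_toFinset] at h1
    rw [h2, map_zero]
    simp only [ne_eq, not_true_eq_false, false_iff]
    rintro rfl
    exact h1 subset_rfl

theorem IsMono.polar {n : ℕ} {K : Finset (Fin n ⊕ Fin n)} {m : Alg n} (h : IsMono K m)
    {i j : Fin n} (hj : Sum.inl j ∈ K) (hi : Sum.inr i ∉ K) :
    IsMono (insert (Sum.inr i) (K.erase (Sum.inl j))) (Fermion.polar i j m) :=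
  (h.contr hj).gen_mul (by simp [hi])

theorem isMono_prod_theta (n : ℕ) :
    IsMono (univ.map Function.Embedding.inl) (List.ofFn (theta (n := n))).prod := by
  refine ⟨List.ofFn Sum.inl, List.nodup_ofFn.2 Sum.inl_injective, ?_, Or.inl ?_⟩
  · ext x; simp [List.mem_ofFn]
  · rw [List.map_ofFn]; rfl

/-! ### The monomials occurring in a fermion. -/

/-- The symbols of the monomials obtained from `θ₁ ⋯ θₙ` by inserting the `ξ_i`, `i ∈ I`, and
deleting the `θ_j`, `j ∈ J`. -/
def supp {n : ℕ} (q : Finset (Fin n) × Finset (Fin n)) : Finset (Fin n ⊕ Fin n) :=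
  (univ \ q.2).map Function.Embedding.inl ∪ q.1.map Function.Embedding.inr

theorem inl_mem_supp {n : ℕ} {q : Finset (Fin n) × Finset (Fin n)} {j : Fin n} :
    Sum.inl j ∈ supp q ↔ j ∉ q.2 := by simp [supp]

theorem inr_mem_supp {n : ℕ} {q : Finset (Fin n) × Finset (Fin n)} {i : Fin n} :
    Sum.inr i ∈ supp q ↔ i ∈ q.1 := by simp [supp]

theorem supp_injective {n : ℕ} : Function.Injective (supp (n := n)) := by
  intro q r h
  ext x
  · rw [← inr_mem_supp, h, inr_mem_supp]
  · rw [← not_iff_not, ← inl_mem_supp, h, inl_mem_supp]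

/-- The index pairs that occur in the block operator of `B`. -/
def choices {n : ℕ} (B : Finset (Fin n)) : Finset (Fin n × Fin n) :=
  if 1 < #B then B.offDiag else B.diag

theorem blockOp_eq_sum {n : ℕ} (B : Finset (Fin n)) :
    blockOp B = ∑ q ∈ choices B, polar q.1 q.2 := by
  unfold blockOp choices
  split_ifs
  · rfl
  · rw [Finset.sum_diag]

theorem mem_of_mem_choices {n : ℕ} {B : Finset (Fin n)} {q : Fin n × Fin n}
    (h : q ∈ choices B) : q.1 ∈ B ∧ q.2 ∈ B := by
  unfold choices at h
  split_ifs at h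
  · rw [Finset.mem_offDiag] at h; exact ⟨h.1, h.2.1⟩
  · rw [Finset.mem_diag] at h; exact ⟨h.1, h.2 ▸ h.1⟩

/-- The pairs of index sets of the monomials that occur in `∏ B ∈ s, ρ_B` applied to
`θ₁ ⋯ θₙ`. -/
structure IsAdmissible {n : ℕ} (s : Finset (Finset (Fin n)))
    (k : Finset (Fin n) × Finset (Fin n)) : Prop where
  fst_subset : k.1 ⊆ s.biUnion id
  snd_subset : k.2 ⊆ s.biUnion id
  exists_choice : ∀ B ∈ s, ∃ q ∈ choices B, k.1 ∩ B = {q.1} ∧ k.2 ∩ B = {q.2}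

/-- Expanding the product means choosing one index pair per block. Since the blocks are disjoint,
the choice can be read off from the resulting index sets, so distinct choices give distinct
monomials and nothing cancels; this is the role of injectivity of `k`. -/
theorem exists_mono_expansion {n : ℕ} (s : Finset (Finset (Fin n)))
    (hs : (s : Set (Finset (Fin n))).PairwiseDisjoint id)
    (comm : (s : Set (Finset (Fin n))).Pairwise (Function.onFun Commute blockOp)) :
    ∃ (ι : Type) (T : Finset ι) (m : ι → Alg n) (k : ι → Finset (Fin n) × Finset (Fin n)),
      s.noncommProd blockOp comm (List.ofFn theta).prod = ∑ a ∈ T, m a ∧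
      (∀ a ∈ T, IsMono (supp (k a)) (m a)) ∧ Set.InjOn k T ∧
      ∀ c, IsAdmissible s c ↔ ∃ a ∈ T, k a = c := by
  induction s using Finset.induction_on with
  | empty =>
    refine ⟨Unit, univ, fun _ => (List.ofFn theta).prod, fun _ => (∅, ∅), ?_, ?_, ?_, ?_⟩
    · simp
    · intro a _
      convert isMono_prod_theta n using 1
      ext x; rcases x with x | x <;> simp [supp]
    · intro a _ b _ _; rfl
    · intro c
      constructor
      · rintro ⟨h1, h2, -⟩
        exact ⟨(), mem_univ _, by ext x <;> simp_all⟩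
      · rintro ⟨a, -, rfl⟩
        exact ⟨by simp, by simp, by simp⟩
  | insert B s hB ih =>
    have hdisj : ∀ x ∈ B, x ∉ s.biUnion id := by
      intro x hx hx'
      obtain ⟨C, hC, hxC⟩ := Finset.mem_biUnion.1 hx'
      have hne : B ≠ C := by rintro rfl; exact hB hC
      exact Finset.disjoint_left.1
        (hs (Finset.mem_insert_self _ _) (Finset.mem_insert_of_mem hC) hne) hx hxC
    obtain ⟨ι, T, m, k, hsum, hmono, hinj, hadm⟩ :=
      ih (hs.subset (by simp)) (comm.mono (by simp))
    have hk1 : ∀ a ∈ T, ∀ x ∈ B, x ∉ (k a).1 := fun a ha x hx hx' =>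
      hdisj x hx (((hadm (k a)).2 ⟨a, ha, rfl⟩).fst_subset hx')
    have hk2 : ∀ a ∈ T, ∀ x ∈ B, x ∉ (k a).2 := fun a ha x hx hx' =>
      hdisj x hx (((hadm (k a)).2 ⟨a, ha, rfl⟩).snd_subset hx')
    refine ⟨(Fin n × Fin n) × ι, choices B ×ˢ T, fun a => polar a.1.1 a.1.2 (m a.2),
      fun a => (insert a.1.1 (k a.2).1, insert a.1.2 (k a.2).2), ?_, ?_, ?_, ?_⟩
    · rw [Finset.noncommProd_insert_of_notMem _ _ _ _ hB, Module.End.mul_apply, hsum,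
        blockOp_eq_sum, LinearMap.sum_apply, Finset.sum_product]
      simp only [map_sum]
    · rintro ⟨q, a⟩ ha
      obtain ⟨hq, ha⟩ := Finset.mem_product.1 ha
      obtain ⟨hq1, hq2⟩ := mem_of_mem_choices hq
      convert (hmono a ha).polar (i := q.1) (j := q.2)
        (inl_mem_supp.2 (hk2 a ha _ hq2)) (fun h => hk1 a ha _ hq1 (inr_mem_supp.1 h)) using 1
      ext x; rcases x with x | x <;> simp [inl_mem_supp, inr_mem_supp]
    · rintro ⟨q, a⟩ ha ⟨r, b⟩ hb hab
      obtain ⟨hq, ha⟩ := Finset.mem_product.1 (Finset.mem_coe.1 ha)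
      obtain ⟨hr, hb⟩ := Finset.mem_product.1 (Finset.mem_coe.1 hb)
      simp only at hq ha hr hb
      obtain ⟨hq1, hq2⟩ := mem_of_mem_choices hq
      obtain ⟨hr1, hr2⟩ := mem_of_mem_choices hr
      simp only [Prod.mk.injEq] at hab
      obtain ⟨h1, h2⟩ := hab
      have e1 : q.1 = r.1 := by
        have : q.1 ∈ insert r.1 (k b).1 := h1 ▸ Finset.mem_insert_self _ _
        exact (Finset.mem_insert.1 this).resolve_right (hk1 b hb _ hq1)
      have e2 : q.2 = r.2 := by
        have : q.2 ∈ insert r.2 (k b).2 := h2 ▸ Finset.mem_insert_self _ _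
        exact (Finset.mem_insert.1 this).resolve_right (hk2 b hb _ hq2)
      rw [e1] at h1
      rw [e2] at h2
      have f1 : (k a).1 = (k b).1 := by
        rw [← Finset.erase_insert (hk1 a ha _ hr1), h1, Finset.erase_insert (hk1 b hb _ hr1)]
      have f2 : (k a).2 = (k b).2 := by
        rw [← Finset.erase_insert (hk2 a ha _ hr2), h2, Finset.erase_insert (hk2 b hb _ hr2)]
      exact Prod.ext (Prod.ext e1 e2) (hinj ha hb (Prod.ext f1 f2))
    · intro c
      constructor
      · rintro ⟨hc1, hc2, hc⟩
        obtain ⟨q, hq, hqc1, hqc2⟩ := hc B (Finset.mem_insert_self _ _)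
        -- Removing the part inside `B` gives an admissible pair for `s`; putting the single chosen
        -- index back recovers the original set.
        have key : ∀ {u : Finset (Fin n)} {y : Fin n}, u ⊆ (insert B s).biUnion id →
            u ∩ B = {y} → insert y (u \ B) = u := by
          intro u y _ hu
          rw [Finset.insert_eq, ← hu, Finset.union_comm, Finset.sdiff_union_inter]
        have hA : IsAdmissible s (c.1 \ B, c.2 \ B) := by
          refine ⟨?_, ?_, ?_⟩
          · intro x hx
            have h := hc1 (Finset.mem_sdiff.1 hx).1
            rw [Finset.biUnion_insert] at h
            exact (Finset.mem_union.1 h).resolve_left (Finset.mem_sdiff.1 hx).2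
          · intro x hx
            have h := hc2 (Finset.mem_sdiff.1 hx).1
            rw [Finset.biUnion_insert] at h
            exact (Finset.mem_union.1 h).resolve_left (Finset.mem_sdiff.1 hx).2
          · intro C hC
            obtain ⟨r, hr, h1, h2⟩ := hc C (Finset.mem_insert_of_mem hC)
            have hCB : C \ B = C := by
              refine Finset.sdiff_eq_self_of_disjoint (Finset.disjoint_left.2 fun x hx hxB => ?_)
              exact hdisj x hxB (Finset.mem_biUnion.2 ⟨C, hC, hx⟩)
            refine ⟨r, hr, ?_, ?_⟩
            · rw [← h1]
              ext x
              have : x ∈ C → x ∉ B := fun h h' => hdisj x h' (Finset.mem_biUnion.2 ⟨C, hC, h⟩)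
              simp only [Finset.mem_inter, Finset.mem_sdiff]; tauto
            · rw [← h2]
              ext x
              have : x ∈ C → x ∉ B := fun h h' => hdisj x h' (Finset.mem_biUnion.2 ⟨C, hC, h⟩)
              simp only [Finset.mem_inter, Finset.mem_sdiff]; tauto
        obtain ⟨a, ha, hac⟩ := (hadm _).1 hA
        refine ⟨(q, a), Finset.mem_product.2 ⟨hq, ha⟩, ?_⟩
        simp only [hac, key hc1 hqc1, key hc2 hqc2]
      · rintro ⟨⟨q, a⟩, ha, rfl⟩
        replace ha := Finset.mem_product.1 ha
        obtain ⟨hq, ha⟩ := ha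
        simp only at hq ha
        obtain ⟨hq1, hq2⟩ := mem_of_mem_choices hq
        obtain ⟨hs1, hs2, hs3⟩ := (hadm (k a)).2 ⟨a, ha, rfl⟩
        refine ⟨?_, ?_, ?_⟩
        · rw [Finset.biUnion_insert]
          exact Finset.insert_subset (Finset.mem_union_left _ hq1)
            (hs1.trans Finset.subset_union_right)
        · rw [Finset.biUnion_insert]
          exact Finset.insert_subset (Finset.mem_union_left _ hq2)
            (hs2.trans Finset.subset_union_right)
        · intro C hC
          rcases Finset.mem_insert.1 hC with rfl | hC
          · refine ⟨q, hq, ?_, ?_⟩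
            · rw [Finset.insert_inter_of_mem hq1,
                Finset.disjoint_iff_inter_eq_empty.1
                  (Finset.disjoint_right.2 (hk1 a ha)), insert_empty_eq]
            · rw [Finset.insert_inter_of_mem hq2,
                Finset.disjoint_iff_inter_eq_empty.1
                  (Finset.disjoint_right.2 (hk2 a ha)), insert_empty_eq]
          · obtain ⟨r, hr, h1, h2⟩ := hs3 C hC
            have hnot : ∀ x ∈ B, x ∉ C := fun x h h' =>
              hdisj x h (Finset.mem_biUnion.2 ⟨C, hC, h'⟩)
            refine ⟨r, hr, ?_, ?_⟩
            · rw [Finset.insert_inter_of_notMem (hnot _ hq1), h1]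
            · rw [Finset.insert_inter_of_notMem (hnot _ hq2), h2]

theorem coeff_F_ne_zero_iff {n : ℕ} (π : SetPartition n)
    (c : Finset (Fin n) × Finset (Fin n)) :
    coeff (supp c) (F π) ≠ 0 ↔ IsAdmissible π.parts c := by
  obtain ⟨ι, T, m, k, hsum, hmono, hinj, hadm⟩ := exists_mono_expansion π.parts
    π.supIndep.pairwiseDisjoint (fun A _ B _ _ => blockOp_commute A B)
  have hF : F π = ∑ a ∈ T, m a := hsum
  rw [hF, map_sum, hadm]
  have h0 : ∀ a ∈ T, k a ≠ c → coeff (supp c) (m a) = 0 := by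
    intro a ha hac
    by_contra h
    exact hac (supp_injective ((hmono a ha).coeff_ne_zero_iff.1 h))
  constructor
  · intro h
    obtain ⟨a, ha, h⟩ := Finset.exists_ne_zero_of_sum_ne_zero h
    exact ⟨a, ha, by by_contra hac; exact h (h0 a ha hac)⟩
  · rintro ⟨a, ha, rfl⟩
    rw [Finset.sum_eq_single_of_mem a ha
      fun b hb hba => h0 b hb fun h => hba (hinj hb ha h)]
    exact (hmono a ha).coeff_ne_zero_iff.2 rfl

end Fermion

/-! ### Noncrossing partitions and the minima and maxima of their blocks. -/

namespace SetPartition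

variable {n : ℕ}

/-- The set of the minima of the blocks. -/
def minima (π : SetPartition n) : Finset (Fin n) := univ.filter fun x => ∀ y ∈ π.part x, x ≤ y

/-- The set of the maxima of the blocks. -/
def maxima (π : SetPartition n) : Finset (Fin n) := univ.filter fun x => ∀ y ∈ π.part x, y ≤ x

theorem mem_part_iff (π : SetPartition n) {x y : Fin n} :
    x ∈ π.part y ↔ π.part x = π.part y :=
  π.mem_part_iff_part_eq_part (mem_univ _) (mem_univ _)

theorem minima_inter (π : SetPartition n) {B : Finset (Fin n)} (hB : B ∈ π.parts) :
    π.minima ∩ B = {B.min' (π.nonempty_of_mem_parts hB)} := by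
  have hne := π.nonempty_of_mem_parts hB
  ext x
  simp only [minima, mem_inter, mem_filter, mem_univ, true_and, mem_singleton]
  constructor
  · rintro ⟨h, hx⟩
    rw [π.part_eq_of_mem hB hx] at h
    exact le_antisymm (h _ (B.min'_mem hne)) (B.min'_le _ hx)
  · rintro rfl
    have hx := B.min'_mem hne
    rw [π.part_eq_of_mem hB hx]
    exact ⟨fun y hy => B.min'_le _ hy, hx⟩

theorem maxima_inter (π : SetPartition n) {B : Finset (Fin n)} (hB : B ∈ π.parts) :
    π.maxima ∩ B = {B.max' (π.nonempty_of_mem_parts hB)} := by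
  have hne := π.nonempty_of_mem_parts hB
  ext x
  simp only [maxima, mem_inter, mem_filter, mem_univ, true_and, mem_singleton]
  constructor
  · rintro ⟨h, hx⟩
    rw [π.part_eq_of_mem hB hx] at h
    exact le_antisymm (B.le_max' _ hx) (h _ (B.max'_mem hne))
  · rintro rfl
    have hx := B.max'_mem hne
    rw [π.part_eq_of_mem hB hx]
    exact ⟨fun y hy => B.le_max' _ hy, hx⟩

theorem isAdmissible_minima_maxima (π : SetPartition n) :
    Fermion.IsAdmissible π.parts (π.minima, π.maxima) := by
  refine ⟨?_, ?_, fun B hB => ⟨(B.min' (π.nonempty_of_mem_parts hB),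
    B.max' (π.nonempty_of_mem_parts hB)), ?_, π.minima_inter hB, π.maxima_inter hB⟩⟩
  · rw [π.biUnion_parts]; exact subset_univ _
  · rw [π.biUnion_parts]; exact subset_univ _
  · unfold Fermion.choices
    split_ifs with h
    · rw [mem_offDiag]
      exact ⟨B.min'_mem (π.nonempty_of_mem_parts hB), B.max'_mem (π.nonempty_of_mem_parts hB),
        (B.min'_lt_max'_of_card h).ne⟩
    · rw [mem_diag]
      have hne := π.nonempty_of_mem_parts hB
      exact ⟨B.min'_mem hne,
        card_le_one.1 (not_lt.1 h) _ (B.min'_mem hne) _ (B.max'_mem hne)⟩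

theorem sum_eq_sum_parts (π : SetPartition n) (I : Finset (Fin n)) (f : Fin n → ℕ) :
    ∑ x ∈ I, f x = ∑ B ∈ π.parts, ∑ x ∈ I ∩ B, f x := by
  rw [← sum_biUnion]
  · congr 1
    rw [← inter_biUnion]
    exact ((congrArg (I ∩ ·) π.biUnion_parts).trans (inter_univ I)).symm
  · intro B hB C hC hBC
    exact (π.supIndep.pairwiseDisjoint hB hC hBC).mono inter_subset_right inter_subset_right

theorem eq_of_inter_parts (π : SetPartition n) {I J : Finset (Fin n)}
    (h : ∀ B ∈ π.parts, I ∩ B = J ∩ B) : I = J := by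
  ext x
  have hx : x ∈ π.part x := π.mem_part (mem_univ x)
  have := congrArg (x ∈ ·) (h _ (π.part_mem.2 (mem_univ x)))
  simpa [hx] using this

/-- An admissible pair selects one element of each block, so the comparison, with its equality case,
holds block by block. With `le_sum_maxima` this makes (minima, maxima) the unique extremal monomial
of `F π`. -/
theorem sum_minima_le (π : SetPartition n) {c : Finset (Fin n) × Finset (Fin n)}
    (h : Fermion.IsAdmissible π.parts c) :
    ∑ x ∈ π.minima, (x : ℕ) ≤ ∑ x ∈ c.1, (x : ℕ) ∧
      (∑ x ∈ π.minima, (x : ℕ) = ∑ x ∈ c.1, (x : ℕ) → π.minima = c.1) := by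
  have key : ∀ B ∈ π.parts, ∑ x ∈ π.minima ∩ B, (x : ℕ) ≤ ∑ x ∈ c.1 ∩ B, (x : ℕ) ∧
      (∑ x ∈ π.minima ∩ B, (x : ℕ) = ∑ x ∈ c.1 ∩ B, (x : ℕ) → π.minima ∩ B = c.1 ∩ B) := by
    intro B hB
    obtain ⟨q, hq, h1, -⟩ := h.exists_choice B hB
    rw [π.minima_inter hB, h1, sum_singleton, sum_singleton]
    refine ⟨B.min'_le _ (Fermion.mem_of_mem_choices hq).1, fun h => ?_⟩
    rw [Fin.val_injective h]
  rw [π.sum_eq_sum_parts π.minima, π.sum_eq_sum_parts c.1]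
  refine ⟨sum_le_sum fun B hB => (key B hB).1, fun h => π.eq_of_inter_parts fun B hB => ?_⟩
  exact (key B hB).2 ((sum_eq_sum_iff_of_le fun B hB => (key B hB).1).1 h B hB)

theorem le_sum_maxima (π : SetPartition n) {c : Finset (Fin n) × Finset (Fin n)}
    (h : Fermion.IsAdmissible π.parts c) :
    ∑ x ∈ c.2, (x : ℕ) ≤ ∑ x ∈ π.maxima, (x : ℕ) ∧
      (∑ x ∈ c.2, (x : ℕ) = ∑ x ∈ π.maxima, (x : ℕ) → c.2 = π.maxima) := by
  have key : ∀ B ∈ π.parts, ∑ x ∈ c.2 ∩ B, (x : ℕ) ≤ ∑ x ∈ π.maxima ∩ B, (x : ℕ) ∧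
      (∑ x ∈ c.2 ∩ B, (x : ℕ) = ∑ x ∈ π.maxima ∩ B, (x : ℕ) → c.2 ∩ B = π.maxima ∩ B) := by
    intro B hB
    obtain ⟨q, hq, -, h1⟩ := h.exists_choice B hB
    rw [π.maxima_inter hB, h1, sum_singleton, sum_singleton]
    refine ⟨B.le_max' _ (Fermion.mem_of_mem_choices hq).2, fun h => ?_⟩
    rw [Fin.val_injective h]
  rw [π.sum_eq_sum_parts π.maxima, π.sum_eq_sum_parts c.2]
  refine ⟨sum_le_sum fun B hB => (key B hB).1, fun h => π.eq_of_inter_parts fun B hB => ?_⟩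
  exact (key B hB).2 ((sum_eq_sum_iff_of_le fun B hB => (key B hB).1).1 h B hB)

theorem exists_lt_of_notMem_minima (π : SetPartition n) {x : Fin n} (hx : x ∉ π.minima) :
    ∃ y < x, π.part y = π.part x := by
  simp only [minima, mem_filter, mem_univ, true_and, not_forall, not_le] at hx
  obtain ⟨y, hy, h⟩ := hx
  exact ⟨y, h, π.mem_part_iff.1 hy⟩

theorem notMem_minima (π : SetPartition n) {x y : Fin n} (h : y < x)
    (hxy : π.part y = π.part x) : x ∉ π.minima := by
  simp only [minima, mem_filter, mem_univ, true_and, not_forall, not_le]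
  exact ⟨y, π.mem_part_iff.2 hxy, h⟩

theorem notMem_maxima (π : SetPartition n) {x y : Fin n} (h : x < y)
    (hxy : π.part y = π.part x) : x ∉ π.maxima := by
  simp only [maxima, mem_filter, mem_univ, true_and, not_forall, not_le]
  exact ⟨y, π.mem_part_iff.2 hxy, h⟩

theorem exists_mem_maxima (π : SetPartition n) (x : Fin n) :
    ∃ z ∈ π.maxima, π.part z = π.part x := by
  have hne : (π.part x).Nonempty := ⟨x, π.mem_part (mem_univ x)⟩
  have hz := π.mem_part_iff.1 ((π.part x).max'_mem hne)
  refine ⟨(π.part x).max' hne, ?_, hz⟩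
  simp only [maxima, mem_filter, mem_univ, true_and, hz]
  exact fun y hy => le_max' _ _ hy

/-- If `σ` does not join `a` to `x`, it joins `x` to some other `a' < x`, as `x` is not a minimum.
The `σ`-block of `a` and the `π`-block of `a'` must both continue beyond `x`: an earlier maximum
would also be a maximum in the other partition, where its block contains `x`. So one partition has a
crossing: `π` if `a < a'`, and `σ` if `a' < a`. -/
theorem IsNoncrossing.part_eq_step {π σ : SetPartition n} (hπ : π.IsNoncrossing)
    (hσ : σ.IsNoncrossing) (hmin : π.minima = σ.minima) (hmax : π.maxima = σ.maxima)
    {x : Fin n} (ih : ∀ a b : Fin n, a < x → b < x →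
      (π.part a = π.part b ↔ σ.part a = σ.part b))
    {a : Fin n} (hax : a < x) (h : π.part a = π.part x) : σ.part a = σ.part x := by
  by_contra hcon
  obtain ⟨a', ha'x, ha'⟩ := σ.exists_lt_of_notMem_minima (hmin ▸ π.notMem_minima hax h)
  have hne : ¬ π.part a = π.part a' := fun h' => hcon (((ih a a' hax ha'x).1 h').trans ha')
  obtain ⟨z', hz'M, hz'⟩ := σ.exists_mem_maxima a
  obtain ⟨z, hzM, hz⟩ := π.exists_mem_maxima a'
  have hxz' : x < z' := by
    rcases lt_trichotomy x z' with h1 | h1 | h1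
    · exact h1
    · subst h1; exact absurd hz'.symm hcon
    · rw [← hmax] at hz'M
      exact absurd hz'M (π.notMem_maxima h1 (h.symm.trans ((ih z' a h1 hax).2 hz').symm))
  have hxz : x < z := by
    rcases lt_trichotomy x z with h1 | h1 | h1
    · exact h1
    · subst h1; exact absurd (h.trans hz) hne
    · rw [hmax] at hzM
      exact absurd hzM (σ.notMem_maxima h1 (ha'.symm.trans ((ih z a' h1 ha'x).1 hz).symm))
  rcases lt_trichotomy a a' with h1 | h1 | h1
  · exact hne (hπ a a' x z h1 ha'x hxz h hz.symm)
  · exact hne (h1 ▸ rfl)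
  · exact hcon ((hσ a' a x z' h1 hax hxz' ha' hz'.symm).symm.trans ha')

/-- A noncrossing partition is determined by the minima and the maxima of its blocks. -/
theorem IsNoncrossing.eq_of_minima_eq_of_maxima_eq {π σ : SetPartition n}
    (hπ : π.IsNoncrossing) (hσ : σ.IsNoncrossing) (hmin : π.minima = σ.minima)
    (hmax : π.maxima = σ.maxima) : π = σ := by
  have key : ∀ N : ℕ, ∀ a b : Fin n, (a : ℕ) < N → (b : ℕ) < N →
      (π.part a = π.part b ↔ σ.part a = σ.part b) := by
    intro N
    induction N with
    | zero => intro a b h; omega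
    | succ N ih =>
      have step : ∀ a x : Fin n, (x : ℕ) = N → a < x →
          (π.part a = π.part x ↔ σ.part a = σ.part x) := by
        intro a x hx hax
        subst hx
        exact ⟨hπ.part_eq_step hσ hmin hmax (fun a b ha hb => ih a b ha hb) hax,
          hσ.part_eq_step hπ hmin.symm hmax.symm (fun a b ha hb => (ih a b ha hb).symm) hax⟩
      intro a b ha hb
      rcases lt_trichotomy a b with h | h | h
      · by_cases hbN : (b : ℕ) = N
        · exact step a b hbN h
        · exact ih a b (by omega) (by omega)
      · subst h; simp
      · by_cases haN : (a : ℕ) = N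
        · rw [eq_comm, step b a haN h, eq_comm]
        · exact ih a b (by omega) (by omega)
  have hpart : ∀ x, π.part x = σ.part x := by
    intro x
    ext y
    rw [π.mem_part_iff, σ.mem_part_iff]
    exact key n y x y.2 x.2
  ext B
  constructor
  · intro hB
    obtain ⟨x, hx⟩ := π.nonempty_of_mem_parts hB
    rw [← π.part_eq_of_mem hB hx, hpart]
    exact σ.part_mem.2 (mem_univ x)
  · intro hB
    obtain ⟨x, hx⟩ := σ.nonempty_of_mem_parts hB
    rw [← σ.part_eq_of_mem hB hx, ← hpart]
    exact π.part_mem.2 (mem_univ x)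

end SetPartition

/-! ### Linear independence by leading monomials. -/

/-- The fermions of the noncrossing set partitions are linearly independent. -/
theorem linearIndependent_F_noncrossing (n : ℕ) :
    LinearIndependent ℂ fun μ : NC n => Fermion.F μ.1 := by
  classical
  rw [Fintype.linearIndependent_iff]
  intro g hg
  by_contra! hne
  -- Take `μ` of maximal weight among the nonzero coefficients. Its leading monomial can occur in `F
  -- ν` only if the weight of `ν` is at least that of `μ`, hence equal, and then minima and maxima
  -- agree.
  let w : NC n → ℤ := fun μ =>
    ((∑ x ∈ μ.1.maxima, (x : ℕ) : ℕ) : ℤ) - ((∑ x ∈ μ.1.minima, (x : ℕ) : ℕ) : ℤ)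
  obtain ⟨μ, hμ, hmax⟩ := Finset.exists_max_image (univ.filter fun μ => g μ ≠ 0) w
    (by obtain ⟨i, hi⟩ := hne; exact ⟨i, by simpa using hi⟩)
  have h0 : Fermion.coeff (Fermion.supp (μ.1.minima, μ.1.maxima))
      (∑ ν, g ν • Fermion.F ν.1) = 0 := by rw [hg, map_zero]
  rw [map_sum, Finset.sum_eq_single μ] at h0
  · rw [map_smul, smul_eq_mul, mul_eq_zero] at h0
    rcases h0 with h0 | h0
    · simp [h0] at hμ
    · exact (Fermion.coeff_F_ne_zero_iff μ.1 _).2 μ.1.isAdmissible_minima_maxima h0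
  · intro ν _ hν
    rw [map_smul, smul_eq_mul, mul_eq_zero]
    by_contra! hc
    have hadm := (Fermion.coeff_F_ne_zero_iff ν.1 _).1 hc.2
    have hle := hmax ν (by simpa using hc.1)
    obtain ⟨h1, h2⟩ := ν.1.sum_minima_le hadm
    obtain ⟨h3, h4⟩ := ν.1.le_sum_maxima hadm
    simp only [w] at h1 h2 h3 h4 hle
    refine hν (Subtype.ext (ν.2.eq_of_minima_eq_of_maxima_eq μ.2 (h2 (by omega)) ?_))
    exact (h4 (by omega)).symm
  · simp

/-! ### The two-block operator as a linear function of the cut. -/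

namespace Fermion

variable {n : ℕ}

theorem polar_mul_swap (i j k l : Fin n) :
    polar i j * polar k l = -(polar k j * polar i l) := by
  refine LinearMap.ext fun f => ?_
  simp only [polar, Module.End.mul_apply, LinearMap.comp_apply, LinearMap.mulLeft_apply,
    dTheta_xi_mul, mul_neg, ← mul_assoc, LinearMap.neg_apply]
  rw [xi_mul_comm i k]
  simp

theorem polar_mul_swap_right (i j k l : Fin n) :
    polar i j * polar k l = -(polar i l * polar k j) := by
  rw [polar_mul_swap, (polar_commute k j i l).eq]

/-- The operator `∑ ξ_i · (θ_j ⊙ f)` over `i ≠ j` in `B`, whatever the size of `B`. -/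
noncomputable def pairOp (B : Finset (Fin n)) : Module.End ℂ (Alg n) :=
  ∑ q ∈ B.offDiag, polar q.1 q.2

theorem blockOp_eq_pairOp {B : Finset (Fin n)} (h : 2 ≤ #B) : blockOp B = pairOp B :=
  if_pos h

theorem pairOp_eq_zero {B : Finset (Fin n)} (h : #B < 2) : pairOp B = 0 := by
  refine sum_eq_zero fun q hq => ?_
  rw [mem_offDiag] at hq
  exact absurd (card_le_one.1 (by omega) _ hq.1 _ hq.2.1) hq.2.2

/-- The indicator function of a finite set. -/
def ind (S : Finset (Fin n)) (x : Fin n) : ℂ := if x ∈ S then 1 else 0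

/-- The cut function of `S`: whether `S` separates `x` from `y`. -/
def cut (S : Finset (Fin n)) (x y : Fin n) : ℂ := (ind S x - ind S y) ^ 2

theorem ind_mul_self (S : Finset (Fin n)) (x : Fin n) : ind S x * ind S x = ind S x := by
  unfold ind; split_ifs <;> simp

theorem ind_compl (S : Finset (Fin n)) (x : Fin n) : ind Sᶜ x = 1 - ind S x := by
  unfold ind; by_cases h : x ∈ S <;> simp [h]

theorem pairOp_eq (S : Finset (Fin n)) :
    pairOp S = ∑ q : Fin n × Fin n, (ind S q.1 * ind S q.2) • polar q.1 q.2 -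
      ∑ i, ind S i • polar i i := by
  have h1 : ∑ i, ind S i • polar i i = ∑ q ∈ S.diag, polar q.1 q.2 := by
    rw [sum_diag, ← Finset.sum_subset (subset_univ S)]
    · exact sum_congr rfl fun i hi => by simp [ind, hi]
    · exact fun i _ hi => by simp [ind, hi]
  have h2 : ∑ q : Fin n × Fin n, (ind S q.1 * ind S q.2) • polar q.1 q.2 =
      ∑ q ∈ S ×ˢ S, polar q.1 q.2 := by
    rw [← Finset.sum_subset (subset_univ (S ×ˢ S))]
    · exact sum_congr rfl fun q hq => by simp [ind, (mem_product.1 hq).1, (mem_product.1 hq).2]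
    · intro q _ hq
      have : q.1 ∈ S → q.2 ∉ S := by simpa using hq
      by_cases h : q.1 ∈ S <;> simp [ind, h, this]
  rw [eq_sub_iff_add_eq, pairOp, h1, h2, ← sum_union (disjoint_diag_offDiag S).symm, union_comm,
    diag_union_offDiag]

/-- The linear combination of the products of two polarization operators with the given
coefficients. -/
noncomputable def quadOp :
    ((Fin n × Fin n) × (Fin n × Fin n) → ℂ) →ₗ[ℂ] Module.End ℂ (Alg n) :=
  Fintype.linearCombination ℂ fun t => polar t.1.1 t.1.2 * polar t.2.1 t.2.2

theorem quadOp_apply (f : (Fin n × Fin n) × (Fin n × Fin n) → ℂ) :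
    quadOp f = ∑ t, f t • (polar t.1.1 t.1.2 * polar t.2.1 t.2.2) :=
  Fintype.linearCombination_apply ℂ _ f

theorem quadOp_swap_left (f : (Fin n × Fin n) × (Fin n × Fin n) → ℂ) :
    quadOp (fun t => f ((t.2.1, t.1.2), (t.1.1, t.2.2))) = -quadOp f := by
  let e : (Fin n × Fin n) × (Fin n × Fin n) ≃ (Fin n × Fin n) × (Fin n × Fin n) :=
    Function.Involutive.toPerm (fun t => ((t.2.1, t.1.2), (t.1.1, t.2.2))) fun _ => rfl
  rw [quadOp_apply, quadOp_apply, ← sum_neg_distrib, ← Equiv.sum_comp e]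
  refine sum_congr rfl fun t _ => ?_
  exact (congrArg (f t • ·) (polar_mul_swap _ _ _ _)).trans (smul_neg _ _)

theorem quadOp_swap_right (f : (Fin n × Fin n) × (Fin n × Fin n) → ℂ) :
    quadOp (fun t => f ((t.1.1, t.2.2), (t.2.1, t.1.2))) = -quadOp f := by
  let e : (Fin n × Fin n) × (Fin n × Fin n) ≃ (Fin n × Fin n) × (Fin n × Fin n) :=
    Function.Involutive.toPerm (fun t => ((t.1.1, t.2.2), (t.2.1, t.1.2))) fun _ => rfl
  rw [quadOp_apply, quadOp_apply, ← sum_neg_distrib, ← Equiv.sum_comp e]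
  refine sum_congr rfl fun t _ => ?_
  exact (congrArg (f t • ·) (polar_mul_swap_right _ _ _ _)).trans (smul_neg _ _)

/-- Swapping the `ξ`-indices or the `θ`-indices changes the sign of `quadOp`, so `f` may be replaced
by its signed average over the four combinations of swaps. -/
theorem quadOp_antisymm (f : (Fin n × Fin n) × (Fin n × Fin n) → ℂ) :
    quadOp f = quadOp fun t => (f t - f ((t.2.1, t.1.2), (t.1.1, t.2.2))
      - f ((t.1.1, t.2.2), (t.2.1, t.1.2)) + f ((t.2.1, t.2.2), (t.1.1, t.1.2))) / 4 := by
  have h1 := quadOp_swap_left f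
  have h2 := quadOp_swap_right f
  have h3 := quadOp_swap_right fun t => f ((t.2.1, t.1.2), (t.1.1, t.2.2))
  have : (fun t => (f t - f ((t.2.1, t.1.2), (t.1.1, t.2.2))
      - f ((t.1.1, t.2.2), (t.2.1, t.1.2)) + f ((t.2.1, t.2.2), (t.1.1, t.1.2))) / 4) =
      (1 / 4 : ℂ) • (f - (fun t => f ((t.2.1, t.1.2), (t.1.1, t.2.2)))
      - (fun t => f ((t.1.1, t.2.2), (t.2.1, t.1.2)))
      + (fun t => f ((t.2.1, t.2.2), (t.1.1, t.1.2)))) := by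
    ext t; simp; ring
  rw [this, map_smul, map_add, map_sub, map_sub, h1, h2, h3, h1]
  module

/-- The operator attached to a function of two indices; on cut functions it gives the product of
the two pair operators, see `pairOp_mul_pairOp_compl`. -/
noncomputable def cutOp (δ : Fin n → Fin n → ℂ) : Module.End ℂ (Alg n) :=
  quadOp (fun t => (δ t.1.1 t.2.2 + δ t.2.1 t.1.2 - δ t.1.1 t.1.2 - δ t.2.1 t.2.2) / 8)
    - ∑ t : (Fin n × Fin n) × Fin n, ((δ t.1.1 t.2 + δ t.1.2 t.2 - δ t.1.1 t.1.2) / 2) •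
        (polar t.1.1 t.1.2 * polar t.2 t.2)
    + ∑ t : Fin n × Fin n, (δ t.1 t.2 / 2) • (polar t.1 t.1 * polar t.2 t.2)

theorem cutOp_sum {κ : Type*} (s : Finset κ) (c : κ → ℂ) (δ : κ → Fin n → Fin n → ℂ) :
    cutOp (fun x y => ∑ a ∈ s, c a * δ a x y) = ∑ a ∈ s, c a • cutOp (δ a) := by
  simp only [cutOp, quadOp_apply, smul_add, smul_sub, sum_add_distrib, sum_sub_distrib, smul_sum,
    smul_smul]
  congr 1
  · congr 1
    · rw [sum_comm]
      refine sum_congr rfl fun t _ => ?_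
      rw [← sum_smul]
      congr 1
      simp only [← sum_add_distrib, ← sum_sub_distrib, sum_div]
      exact sum_congr rfl fun a _ => by ring
    · rw [sum_comm]
      refine sum_congr rfl fun t _ => ?_
      rw [← sum_smul]
      congr 1
      simp only [← sum_add_distrib, ← sum_sub_distrib, sum_div]
      exact sum_congr rfl fun a _ => by ring
  · rw [sum_comm]
    refine sum_congr rfl fun t _ => ?_
    rw [← sum_smul]
    congr 1
    simp only [sum_div]
    exact sum_congr rfl fun a _ => by ring

theorem smul_sum_mul_smul_sum {ι κ : Type*} [Fintype ι] [Fintype κ] (a : ι → ℂ) (b : κ → ℂ)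
    (X : ι → Module.End ℂ (Alg n)) (Y : κ → Module.End ℂ (Alg n)) :
    (∑ i, a i • X i) * (∑ k, b k • Y k) = ∑ t : ι × κ, (a t.1 * b t.2) • (X t.1 * Y t.2) := by
  rw [sum_mul_sum, Fintype.sum_prod_type]
  simp only [smul_mul_smul_comm]

/-- Write each factor as a full double sum minus its diagonal. In every resulting product the terms
of degree above two in the indicator of `S` cancel, and the rest is linear in the cut of `S`. -/
theorem pairOp_mul_pairOp_compl (S : Finset (Fin n)) :
    pairOp S * pairOp Sᶜ = cutOp (cut S) := by
  have hcomm : Commute (∑ i, ind S i • polar i i)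
      (∑ q : Fin n × Fin n, (ind Sᶜ q.1 * ind Sᶜ q.2) • polar q.1 q.2) :=
    Commute.sum_left _ _ _ fun i _ => Commute.sum_right _ _ _ fun q _ =>
      ((polar_commute i i q.1 q.2).smul_left _).smul_right _
  have hcut : ∀ x y, cut S x y = ind S x + ind S y - 2 * (ind S x * ind S y) := by
    intro x y
    rw [cut]
    linear_combination ind_mul_self S x + ind_mul_self S y
  rw [pairOp_eq, pairOp_eq, sub_mul, mul_sub, mul_sub, hcomm.eq]
  have e1 : (∑ q : Fin n × Fin n, (ind S q.1 * ind S q.2) • polar q.1 q.2) *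
      (∑ q : Fin n × Fin n, (ind Sᶜ q.1 * ind Sᶜ q.2) • polar q.1 q.2) =
      quadOp (fun t => (cut S t.1.1 t.2.2 + cut S t.2.1 t.1.2 - cut S t.1.1 t.1.2
        - cut S t.2.1 t.2.2) / 8) := by
    -- With `s` the indicator, antisymmetrizing `s i * s j * (1 - s k) * (1 - s l)` gives `(s i - s
    -- k) * (s j - s l) / 4`.
    rw [smul_sum_mul_smul_sum, ← quadOp_apply, quadOp_antisymm]
    congr 1
    ext t
    simp only [hcut, ind_compl]
    ring
  -- The cubic terms cancel only between the two mixed products, so these are treated together.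
  have e2 : (∑ q : Fin n × Fin n, (ind S q.1 * ind S q.2) • polar q.1 q.2) *
      (∑ i, ind Sᶜ i • polar i i) + (∑ q : Fin n × Fin n, (ind Sᶜ q.1 * ind Sᶜ q.2) •
        polar q.1 q.2) * (∑ i, ind S i • polar i i) =
      ∑ t : (Fin n × Fin n) × Fin n, ((cut S t.1.1 t.2 + cut S t.1.2 t.2 - cut S t.1.1 t.1.2) / 2) •
        (polar t.1.1 t.1.2 * polar t.2 t.2) := by
    rw [smul_sum_mul_smul_sum, smul_sum_mul_smul_sum, ← sum_add_distrib]
    refine sum_congr rfl fun t _ => ?_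
    rw [← add_smul]
    congr 1
    simp only [hcut, ind_compl]
    ring
  have e3 : (∑ i, ind S i • polar i i) * (∑ i, ind Sᶜ i • polar (n := n) i i) =
      ∑ t : Fin n × Fin n, (cut S t.1 t.2 / 2) • (polar t.1 t.1 * polar t.2 t.2) := by
    rw [smul_sum_mul_smul_sum]
    -- The diagonal product is symmetrized by exchanging its two indices, which is allowed since
    -- polarizations commute.
    have h : ∀ X : Module.End ℂ (Alg n), X = (1 / 2 : ℂ) • (X + X) := by intro X; module
    rw [h (∑ t : Fin n × Fin n, (ind S t.1 * ind Sᶜ t.2) • (polar t.1 t.1 * polar t.2 t.2))]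
    conv_lhs => enter [2, 2]; rw [← Equiv.sum_comp (Equiv.prodComm _ _)]
    rw [← sum_add_distrib, smul_sum]
    refine sum_congr rfl fun t _ => ?_
    simp only [Equiv.prodComm_apply, Prod.fst_swap, Prod.snd_swap]
    rw [(polar_commute t.2 t.2 t.1 t.1).eq, ← add_smul, smul_smul]
    congr 1
    simp only [hcut, ind_compl]
    ring
  rw [cutOp, ← e1, ← e2, ← e3]
  abel

end Fermion

/-! ### Telescoping sums and the decomposition of cuts into interval cuts. -/

theorem sum_Ico_cyclic_sub {N : ℕ} {M : Type*} [AddCommGroup M] (s : Fin (N + 1) → M)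
    {x y : Fin (N + 1)} (h : x ≤ y) : ∑ i ∈ Ico x y, (s (i + 1) - s i) = s y - s x := by
  obtain ⟨y, hy⟩ := y
  have hx : (x : ℕ) ≤ y := h
  induction y, hx using Nat.le_induction with
  | base => simp
  | succ k hk ih =>
    have hk' : k < N + 1 := by omega
    have he : Ico x ⟨k + 1, hy⟩ = insert ⟨k, hk'⟩ (Ico x ⟨k, hk'⟩) := by
      ext z
      simp only [mem_Ico, mem_insert, Fin.le_def, Fin.lt_def, Fin.ext_iff]
      omega
    have hs : (⟨k, hk'⟩ + 1 : Fin (N + 1)) = ⟨k + 1, hy⟩ := by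
      ext
      rw [Fin.val_add_one_of_lt (by rw [Fin.lt_def]; simp; omega)]
    rw [he, sum_insert (by simp), ih hk' hk, hs]
    abel

theorem sum_univ_cyclic_sub {N : ℕ} {M : Type*} [AddCommGroup M] (s : Fin (N + 1) → M) :
    ∑ i, (s (i + 1) - s i) = 0 := by
  rw [sum_sub_distrib]
  exact sub_eq_zero.2 (Equiv.sum_comp (Equiv.addRight (1 : Fin (N + 1))) s)

theorem sum_Ioc_cyclic_sub {N : ℕ} {M : Type*} [AddCommGroup M] (s : Fin (N + 1) → M)
    {i j : Fin (N + 1)} (h : i ≤ j) :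
    ∑ x ∈ Ioc i j, (s (x + 1) - s x) = s (j + 1) - s (i + 1) := by
  have h1 : ∑ x ∈ Icc i j, (s (x + 1) - s x) = (s (i + 1) - s i) +
      ∑ x ∈ Ioc i j, (s (x + 1) - s x) := by
    rw [← Ioc_insert_left h, sum_insert (by simp)]
  have h2 : ∑ x ∈ Icc i j, (s (x + 1) - s x) = (s (j + 1) - s j) +
      ∑ x ∈ Ico i j, (s (x + 1) - s x) := by
    rw [← Ico_insert_right h, sum_insert (by simp)]
  rw [h1, sum_Ico_cyclic_sub s h] at h2
  rw [← add_right_inj (s (i + 1) - s i), h2]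
  abel

theorem two_mul_sum_lt {N : ℕ} (f : Fin N → Fin N → ℂ) (hf : ∀ i j, f i j = f j i)
    (hd : ∀ i, f i i = 0) :
    2 * ∑ p : Fin N × Fin N with p.1 < p.2, f p.1 p.2 = ∑ i, ∑ j, f i j := by
  rw [← Fintype.sum_prod_type', ← sum_filter_add_sum_filter_not univ
    (fun p : Fin N × Fin N => p.1 < p.2), two_mul]
  congr 1
  have hz : ∑ p ∈ (univ.filter fun p : Fin N × Fin N => ¬ p.1 < p.2) with ¬ p.2 < p.1,
      f p.1 p.2 = 0 := by
    refine sum_eq_zero fun p hp => ?_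
    simp only [not_lt, mem_filter, mem_univ, true_and] at hp
    rw [le_antisymm hp.1 hp.2, hd]
  rw [← sum_filter_add_sum_filter_not (univ.filter fun p : Fin N × Fin N => ¬ p.1 < p.2)
    (fun p : Fin N × Fin N => p.2 < p.1), hz, add_zero]
  · refine sum_nbij' Prod.swap Prod.swap ?_ ?_ ?_ ?_ ?_
    · intro p hp; simp at hp ⊢; exact ⟨hp.le, hp⟩
    · intro p hp; simp at hp ⊢; exact hp.2
    · simp
    · simp
    · intro p _; exact hf _ _

namespace Fermion

/-- Duality of chords: `{i, j}` separates `x` from `y` exactly when `{x, y}` separates `i` from `j`.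
The half-open conventions regard `i` as the gap following `i`. -/
theorem cut_Ioc {N : ℕ} {i j x y : Fin N} (hij : i < j) (hxy : x ≤ y) :
    cut (Ioc i j) x y = (ind (Ico x y) i - ind (Ico x y) j) ^ 2 := by
  unfold cut ind
  simp only [mem_Ioc, mem_Ico, Fin.le_def, Fin.lt_def] at *
  split_ifs <;> first | omega | norm_num

theorem cut_comm {n : ℕ} (S : Finset (Fin n)) (x y : Fin n) : cut S x y = cut S y x := by
  unfold cut; ring

/-- The cyclic increment of the indicator function of `A` at `x`. -/
noncomputable def incr {N : ℕ} (A : Finset (Fin (N + 1))) (x : Fin (N + 1)) : ℂ :=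
  ind A (x + 1) - ind A x

/-- Every cut function is a combination of the cut functions of intervals. -/
theorem cut_eq_sum_cut_Ioc {N : ℕ} (A : Finset (Fin (N + 1))) (x y : Fin (N + 1)) :
    cut A x y = ∑ p : Fin (N + 1) × Fin (N + 1) with p.1 < p.2,
      -(incr A p.1 * incr A p.2) * cut (Ioc p.1 p.2) x y := by
  wlog hxy : x ≤ y generalizing x y
  · rw [cut_comm, this y x (le_of_not_ge hxy)]
    exact sum_congr rfl fun p _ => by rw [cut_comm]
  have h1 : ∑ p : Fin (N + 1) × Fin (N + 1) with p.1 < p.2,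
      -(incr A p.1 * incr A p.2) * cut (Ioc p.1 p.2) x y =
      ∑ p : Fin (N + 1) × Fin (N + 1) with p.1 < p.2,
        -(incr A p.1 * incr A p.2) * (ind (Ico x y) p.1 - ind (Ico x y) p.2) ^ 2 :=
    sum_congr rfl fun p hp => by rw [cut_Ioc (mem_filter.1 hp).2 hxy]
  have h2 := two_mul_sum_lt
    (fun i j => -(incr A i * incr A j) * (ind (Ico x y) i - ind (Ico x y) j) ^ 2)
    (fun i j => by ring) (fun i => by ring)
  have h3 : ∑ i, incr A i = 0 := sum_univ_cyclic_sub (ind A)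
  have h4 : ∑ i, ind (Ico x y) i * incr A i = ind A y - ind A x := by
    rw [← sum_Ico_cyclic_sub (ind A) hxy, ← sum_subset (subset_univ (Ico x y))]
    · exact sum_congr rfl fun i hi => by simp [ind, incr, hi]
    · intro i _ hi; simp [ind, hi]
  -- Expanding the square leaves twice the square of the telescoping sum from `x` to `y`, plus a
  -- term killed by the vanishing of the total increment.
  have h5 : ∑ i, ∑ j, -(incr A i * incr A j) * (ind (Ico x y) i - ind (Ico x y) j) ^ 2 =
      2 * ((∑ i, ind (Ico x y) i * incr A i) * (∑ i, ind (Ico x y) i * incr A i))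
      - 2 * ((∑ i, ind (Ico x y) i * incr A i) * ∑ i, incr A i) := by
    have hs : ∑ i, ∑ j, (ind (Ico x y) i * incr A i) * incr A j =
        ∑ i, ∑ j, (ind (Ico x y) j * incr A j) * incr A i := by rw [sum_comm]
    have h6 : ∀ i j, -(incr A i * incr A j) * (ind (Ico x y) i - ind (Ico x y) j) ^ 2 =
        2 * ((ind (Ico x y) i * incr A i) * (ind (Ico x y) j * incr A j))
        - (ind (Ico x y) i * incr A i) * incr A j - (ind (Ico x y) j * incr A j) * incr A i := by
      intro i j
      linear_combination -(incr A i * incr A j) * ind_mul_self (Ico x y) i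
        - (incr A i * incr A j) * ind_mul_self (Ico x y) j
    simp only [h6, sum_sub_distrib]
    rw [← hs, sum_mul_sum, sum_mul_sum]
    simp only [mul_sum]
    rw [sub_sub]
    congr 1
    simp only [← two_mul, mul_sum]
  rw [h1]
  rw [h5, h3, h4] at h2
  unfold cut
  linear_combination -h2 / 2

theorem pairOp_mul_pairOp_compl_eq_sum {N : ℕ} (A : Finset (Fin (N + 1))) :
    pairOp A * pairOp Aᶜ = ∑ p : Fin (N + 1) × Fin (N + 1) with p.1 < p.2,
      (-(incr A p.1 * incr A p.2)) • (pairOp (Ioc p.1 p.2) * pairOp (Ioc p.1 p.2)ᶜ) := by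
  simp only [pairOp_mul_pairOp_compl]
  rw [← cutOp_sum]
  congr 1
  ext x y
  exact cut_eq_sum_cut_Ioc A x y

theorem F_eq_of_parts_eq_pair {n : ℕ} {π : SetPartition n} {A B : Finset (Fin n)}
    (h : π.parts = {A, B}) (hAB : A ≠ B) :
    F π = (blockOp A * blockOp B) (List.ofFn theta).prod := by
  -- Generalizing the commutation proof allows `π.parts` to be rewritten in the dependent
  -- `noncommProd`.
  have key : ∀ comm : (π.parts : Set (Finset (Fin n))).Pairwise (Function.onFun Commute blockOp),
      π.parts.noncommProd blockOp comm = blockOp A * blockOp B := by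
    rw [h]
    intro comm
    rw [Finset.noncommProd_insert_of_notMem _ _ _ _ (by simpa using hAB), noncommProd_singleton]
  exact congrArg (fun f : Module.End ℂ (Alg n) => f (List.ofFn theta).prod) (key _)

end Fermion

/-! ### Two-block noncrossing partitions as intervals. -/

namespace SetPartition

variable {n : ℕ}

theorem eq_compl_of_parts_eq_pair {π : SetPartition n} {A B : Finset (Fin n)}
    (h : π.parts = {A, B}) (hAB : A ≠ B) : B = Aᶜ := by
  have hd : Disjoint A B := π.supIndep.pairwiseDisjoint (by simp [h]) (by simp [h]) hAB
  have hu := π.biUnion_parts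
  rw [h] at hu
  simp only [biUnion_insert, singleton_biUnion, id_eq] at hu
  exact (IsCompl.of_eq hd.eq_bot hu).compl_eq.symm

/-- The set partition into a set and its complement. -/
def ofCompl (S : Finset (Fin n)) (h : S.Nonempty) (h' : Sᶜ.Nonempty) : SetPartition n where
  parts := {S, Sᶜ}
  supIndep := by
    rw [supIndep_pair (fun he => by
      have hd : Disjoint S Sᶜ := disjoint_compl_right
      rw [← he, disjoint_self] at hd
      exact h.ne_empty hd)]
    exact disjoint_compl_right
  sup_parts := by simp
  bot_notMem := by
    simp only [bot_eq_empty, mem_insert, mem_singleton, not_or]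
    exact ⟨h.ne_empty.symm, h'.ne_empty.symm⟩

theorem part_ofCompl (S : Finset (Fin n)) (h : S.Nonempty) (h' : Sᶜ.Nonempty) (x : Fin n) :
    (ofCompl S h h').part x = if x ∈ S then S else Sᶜ := by
  refine Finpartition.part_eq_of_mem _ ?_ ?_
  · split_ifs <;> simp [ofCompl]
  · split_ifs with hx
    · exact hx
    · simpa using hx

theorem part_ofCompl_eq_iff (S : Finset (Fin n)) (h : S.Nonempty) (h' : Sᶜ.Nonempty)
    (x y : Fin n) :
    (ofCompl S h h').part x = (ofCompl S h h').part y ↔ (x ∈ S ↔ y ∈ S) := by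
  rw [← mem_part_iff, part_ofCompl]
  split_ifs with hy <;> simp [hy]

theorem ofCompl_Ioc_isNoncrossing {i j : Fin n} (h : (Ioc i j).Nonempty)
    (h' : (Ioc i j)ᶜ.Nonempty) : (ofCompl (Ioc i j) h h').IsNoncrossing := by
  intro a b c d hab hbc hcd
  simp only [part_ofCompl_eq_iff, mem_Ioc, Fin.lt_def, Fin.le_def] at *
  omega

theorem exists_parts_eq_Ioc {N : ℕ} {π : SetPartition (N + 1)} (hπ : π.IsNoncrossing)
    (h2 : #π.parts = 2) :
    ∃ i j : Fin (N + 1), i < j ∧ π.parts = {Ioc i j, (Ioc i j)ᶜ} := by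
  obtain ⟨S, hS, h0S⟩ : ∃ S ∈ π.parts, (0 : Fin (N + 1)) ∉ S := by
    by_contra! hc
    have : #π.parts ≤ 1 := card_le_one.2 fun S hS T hT =>
      π.eq_of_mem_parts hS hT (hc S hS) (hc T hT)
    omega
  obtain ⟨T, hST, hT⟩ : ∃ T, S ≠ T ∧ π.parts = {S, T} := by
    obtain ⟨U, V, hUV, h⟩ := card_eq_two.1 h2
    rw [h] at hS
    rcases mem_insert.1 hS with rfl | hS
    · exact ⟨V, hUV, h⟩
    · rw [mem_singleton.1 hS]
      exact ⟨U, hUV.symm, by rw [h, pair_comm]⟩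
  have hT' := eq_compl_of_parts_eq_pair hT hST
  subst hT'
  have hne := π.nonempty_of_mem_parts hS
  have hlo := S.min'_mem hne
  have hhi := S.max'_mem hne
  have hpos : (S.min' hne : ℕ) ≠ 0 := fun h => h0S (by
    rwa [show S.min' hne = 0 from Fin.ext h] at hlo)
  have hmem : ∀ x, π.part x = if x ∈ S then S else Sᶜ := by
    intro x
    refine π.part_eq_of_mem ?_ ?_
    · split_ifs <;> simp [hT]
    · split_ifs with hx
      · exact hx
      · simpa using hx
  -- The block avoiding `0` has no gap: a missing `x` between its minimum and maximum would give a
  -- crossing with `0`. The left endpoint is one below the minimum, which is positive.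
  have hint : S = Ioc ⟨(S.min' hne : ℕ) - 1, by omega⟩ (S.max' hne) := by
    ext x
    simp only [mem_Ioc, Fin.lt_def, Fin.le_def]
    constructor
    · intro hx
      have h1 : (S.min' hne : ℕ) ≤ x := S.min'_le x hx
      have h3 : (x : ℕ) ≤ S.max' hne := S.le_max' x hx
      omega
    · rintro ⟨h1, h3⟩
      by_contra hx
      have h4 : (S.min' hne : ℕ) ≠ x := fun h => hx (Fin.ext h ▸ hlo)
      have h5 : (S.max' hne : ℕ) ≠ x := fun h => hx (Fin.ext h ▸ hhi)
      have := hπ 0 (S.min' hne) x (S.max' hne) (Fin.pos_iff_ne_zero.2 fun h => hpos (by rw [h]; rfl))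
        (by rw [Fin.lt_def]; omega) (by rw [Fin.lt_def]; omega)
        (by rw [hmem, hmem, if_neg h0S, if_neg hx]) (by rw [hmem, hmem, if_pos hlo, if_pos hhi])
      rw [hmem, hmem, if_neg h0S, if_pos hlo] at this
      exact hST this.symm
  refine ⟨_, _, ?_, by rw [hT, ← hint]⟩
  have h1 : (S.min' hne : ℕ) ≤ S.max' hne := S.min'_le _ hhi
  rw [Fin.lt_def]
  simp only
  omega

/-- Two-block noncrossing partitions correspond to pairs `i < j`. -/
theorem sum_two_block_noncrossing {N : ℕ} {M : Type*} [AddCommMonoid M]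
    (f : Fin (N + 1) × Fin (N + 1) → M) (g : NC (N + 1) → M)
    (hfg : ∀ (i j : Fin (N + 1)) (μ : NC (N + 1)), i < j →
      μ.1.parts = {Ioc i j, (Ioc i j)ᶜ} → f (i, j) = g μ) :
    ∑ p : Fin (N + 1) × Fin (N + 1) with p.1 < p.2, f p =
      ∑ μ : NC (N + 1) with #μ.1.parts = 2, g μ := by
  have h : ∀ p : Fin (N + 1) × Fin (N + 1), p ∈ univ.filter (fun p => p.1 < p.2) →
      (Ioc p.1 p.2).Nonempty ∧ (Ioc p.1 p.2)ᶜ.Nonempty := by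
    intro p hp
    exact ⟨nonempty_Ioc.2 (mem_filter.1 hp).2, ⟨p.1, by simp⟩⟩
  refine sum_bij (fun p hp => ⟨ofCompl (Ioc p.1 p.2) (h p hp).1 (h p hp).2,
    ofCompl_Ioc_isNoncrossing _ _⟩) ?_ ?_ ?_ ?_
  · intro p hp
    refine mem_filter.2 ⟨mem_univ _, card_pair fun he => ?_⟩
    have := (h p hp).1
    have hd : Disjoint (Ioc p.1 p.2) (Ioc p.1 p.2)ᶜ := disjoint_compl_right
    rw [← he, disjoint_self] at hd
    exact this.ne_empty hd
  · intro p hp q hq hpq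
    have h1 : ({Ioc p.1 p.2, (Ioc p.1 p.2)ᶜ} : Finset _) = {Ioc q.1 q.2, (Ioc q.1 q.2)ᶜ} :=
      congrArg (fun μ : NC (N + 1) => μ.1.parts) hpq
    have h2 : Ioc p.1 p.2 ∈ ({Ioc q.1 q.2, (Ioc q.1 q.2)ᶜ} : Finset _) := by rw [← h1]; simp
    have h3 : Ioc p.1 p.2 = Ioc q.1 q.2 := by
      rcases mem_insert.1 h2 with h2 | h2
      · exact h2
      -- No `Ioc` contains `0`, which tells the interval from its complement.
      · have : (0 : Fin (N + 1)) ∈ (Ioc q.1 q.2)ᶜ := by simp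
        rw [← mem_singleton.1 h2] at this
        simp at this
    have hp' := (mem_filter.1 hp).2
    have hq' := (mem_filter.1 hq).2
    rw [Finset.ext_iff] at h3
    have h4 := h3 p.2
    have h5 := h3 q.2
    have h6 := h3 p.1
    have h7 := h3 q.1
    simp only [mem_Ioc, Fin.lt_def, Fin.le_def] at h4 h5 h6 h7 hp' hq'
    ext <;> omega
  · intro μ hμ
    obtain ⟨i, j, hij, hparts⟩ := exists_parts_eq_Ioc μ.2 (mem_filter.1 hμ).2
    refine ⟨(i, j), by simpa using hij, Subtype.ext (Finpartition.ext hparts.symm)⟩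
  · intro p hp
    exact hfg p.1 p.2 _ (mem_filter.1 hp).2 rfl

end SetPartition

/-! ### Cyclic intervals. -/

section CyclicIcc

variable {N : ℕ}

theorem Fin.val_sub_eq (x y : Fin (N + 1)) :
    ((x - y : Fin (N + 1)) : ℕ) = if y ≤ x then (x : ℕ) - y else N + 1 + x - y := by
  split_ifs with h
  · exact Fin.sub_val_of_le h
  · exact Fin.coe_sub_iff_lt.2 (not_le.1 h)

/-- Modular distance from `u` treats wrapping and non-wrapping intervals alike, and supports
induction along the cycle. -/
theorem mem_cyclicIcc {u v y : Fin (N + 1)} :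
    y ∈ cyclicIcc u v ↔ ((y - u : Fin (N + 1)) : ℕ) ≤ ((v - u : Fin (N + 1)) : ℕ) := by
  unfold cyclicIcc
  rw [Fin.val_sub_eq, Fin.val_sub_eq]
  split_ifs <;> simp only [mem_filter, mem_univ, true_and, Fin.le_def] at * <;> omega

theorem left_mem_cyclicIcc (u v : Fin (N + 1)) : u ∈ cyclicIcc u v := by
  simp [mem_cyclicIcc]

theorem right_mem_cyclicIcc (u v : Fin (N + 1)) : v ∈ cyclicIcc u v := by
  simp [mem_cyclicIcc]

theorem succ_mem_cyclicIcc {u v x : Fin (N + 1)} (hx : x ∈ cyclicIcc u v) (hxv : x ≠ v) :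
    x + 1 ∈ cyclicIcc u v := by
  rw [mem_cyclicIcc] at *
  have h1 : x - u ≠ v - u := fun h => hxv (sub_left_injective h)
  have h2 : ((x - u : Fin (N + 1)) : ℕ) ≠ (v - u : Fin (N + 1)) := fun h => h1 (Fin.ext h)
  rw [show x + 1 - u = x - u + 1 by abel, Fin.val_add_one_of_lt]
  · omega
  · rw [Fin.lt_def, Fin.val_last]; omega

theorem pred_mem_cyclicIcc {u v x : Fin (N + 1)} (hx : x ∈ cyclicIcc u v) (hxu : x ≠ u) :
    x - 1 ∈ cyclicIcc u v ∧ x - 1 ≠ v ∧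
      ((x - 1 - u : Fin (N + 1)) : ℕ) + 1 = ((x - u : Fin (N + 1)) : ℕ) := by
  have h0 : x - u ≠ 0 := sub_ne_zero.2 hxu
  have h1 : ((x - 1 - u : Fin (N + 1)) : ℕ) + 1 = ((x - u : Fin (N + 1)) : ℕ) := by
    have h2 : ((x - u : Fin (N + 1)) : ℕ) ≠ 0 := fun h => h0 (Fin.ext h)
    rw [show x - 1 - u = x - u - 1 by abel, Fin.val_sub_one_of_ne_zero h0]
    omega
  rw [mem_cyclicIcc] at *
  refine ⟨by omega, ?_, h1⟩
  rintro rfl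
  omega

/-- A property that does not change inside a cyclic interval is constant on it. -/
theorem iff_of_mem_cyclicIcc {u v : Fin (N + 1)} {f : Fin (N + 1) → Prop}
    (hf : ∀ x ∈ cyclicIcc u v, x ≠ v → (f x ↔ f (x + 1))) {y : Fin (N + 1)}
    (hy : y ∈ cyclicIcc u v) : f u ↔ f y := by
  obtain ⟨k, hk⟩ : ∃ k : ℕ, ((y - u : Fin (N + 1)) : ℕ) = k := ⟨_, rfl⟩
  induction k generalizing y with
  | zero => rw [sub_eq_zero.1 (Fin.ext hk : y - u = 0)]
  | succ k ih =>
    have hyu : y ≠ u := by rintro rfl; simp at hk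
    obtain ⟨h1, h2, h3⟩ := pred_mem_cyclicIcc hy hyu
    rw [ih h1 (by omega), hf _ h1 h2, sub_add_cancel]

end CyclicIcc

/-! ### Breaks and unions of pieces. -/

/-- `x` and its cyclic successor lie on different sides of `A`. -/
def IsBreak {N : ℕ} (A : Finset (Fin (N + 1))) (x : Fin (N + 1)) : Prop :=
  ¬ (x ∈ A ↔ x + 1 ∈ A)

namespace IsCyclicDecomposition

variable {N m : ℕ} {A : Finset (Fin (N + 1))} {As Bs : Fin m → Finset (Fin (N + 1))}

theorem exists_piece (h : IsCyclicDecomposition A Aᶜ As Bs) (x : Fin (N + 1)) :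
    ∃ p, x ∈ Sum.elim As Bs p := by
  by_cases hx : x ∈ A
  · rw [← h.union_left] at hx
    obtain ⟨i, -, hi⟩ := mem_biUnion.1 hx
    exact ⟨Sum.inl i, hi⟩
  · rw [← mem_compl, ← h.union_right] at hx
    obtain ⟨i, -, hi⟩ := mem_biUnion.1 hx
    exact ⟨Sum.inr i, hi⟩

theorem piece_subset_left (h : IsCyclicDecomposition A Aᶜ As Bs) (i : Fin m) : As i ⊆ A :=
  (h.maximal_left i).1.2

theorem piece_subset_right (h : IsCyclicDecomposition A Aᶜ As Bs) (i : Fin m) : Bs i ⊆ Aᶜ :=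
  (h.maximal_right i).1.2

theorem eq_of_mem_piece (h : IsCyclicDecomposition A Aᶜ As Bs) {x : Fin (N + 1)}
    {p q : Fin m ⊕ Fin m} (hp : x ∈ Sum.elim As Bs p) (hq : x ∈ Sum.elim As Bs q) : p = q := by
  rcases p with i | i <;> rcases q with j | j <;> simp only [Sum.elim_inl, Sum.elim_inr] at hp hq
  · by_contra hne
    exact Finset.disjoint_left.1 (h.disjoint_left i j fun h => hne (by rw [h])) hp hq
  · exact absurd (h.piece_subset_left i hp) (mem_compl.1 (h.piece_subset_right j hq))
  · exact absurd (h.piece_subset_left j hq) (mem_compl.1 (h.piece_subset_right i hp))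
  · by_contra hne
    exact Finset.disjoint_left.1 (h.disjoint_right i j fun h => hne (by rw [h])) hp hq

/-- Each piece is a cyclic interval whose only break is its last element. -/
theorem exists_ends (h : IsCyclicDecomposition A Aᶜ As Bs) :
    ∃ b e : Fin m ⊕ Fin m → Fin (N + 1), ∀ p, Sum.elim As Bs p = cyclicIcc (b p) (e p) ∧
      ∀ x ∈ Sum.elim As Bs p, IsBreak A x ↔ x = e p := by
  obtain ⟨a, a', b, b', h1, h2, h3, h4⟩ := h.sequential
  refine ⟨Sum.elim a b, Sum.elim a' b', ?_⟩
  rintro (i | i) <;> simp only [Sum.elim_inl, Sum.elim_inr]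
  · refine ⟨h1 i, fun x hx => ⟨fun hbr => ?_, ?_⟩⟩
    · by_contra hne
      refine hbr (iff_of_true (h.piece_subset_left i hx) (h.piece_subset_left i ?_))
      rw [h1] at hx ⊢
      exact succ_mem_cyclicIcc hx hne
    · rintro rfl
      have hb : a' i + 1 ∈ Aᶜ := by
        refine h.piece_subset_right i ?_
        rw [h2, h3, finRotate_apply]
        exact left_mem_cyclicIcc _ _
      have ha := h.piece_subset_left i hx
      unfold IsBreak
      rw [mem_compl] at hb
      tauto
  · refine ⟨h2 i, fun x hx => ⟨fun hbr => ?_, ?_⟩⟩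
    · by_contra hne
      refine hbr (iff_of_false (mem_compl.1 (h.piece_subset_right i hx))
        (mem_compl.1 (h.piece_subset_right i ?_)))
      rw [h2] at hx ⊢
      exact succ_mem_cyclicIcc hx hne
    · rintro rfl
      have hb : b' i + 1 ∈ A := by
        refine h.piece_subset_left (finRotate m i) ?_
        rw [h1, h4, finRotate_apply]
        exact left_mem_cyclicIcc _ _
      have ha := h.piece_subset_right i hx
      unfold IsBreak
      rw [mem_compl] at ha
      tauto

-- A set is a union of pieces when it never changes inside one, and a piece can change only after
-- its last element. That element is also the only break of `A` in the piece, so counting pieces is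
-- counting breaks.
open Classical in
theorem isUnionOfPieces_iff (h : IsCyclicDecomposition A Aᶜ As Bs) (par : ℕ → Prop)
    (S : Finset (Fin (N + 1))) :
    IsUnionOfPieces As Bs par S ↔
      (∀ x, IsBreak S x → IsBreak A x) ∧ par #(S.filter (IsBreak A)) := by
  obtain ⟨b, e, he⟩ := h.exists_ends
  have hmem : ∀ p, e p ∈ Sum.elim As Bs p := fun p => by
    rw [(he p).1]; exact right_mem_cyclicIcc _ _
  have hcard : ∀ P : Finset (Fin m ⊕ Fin m), S = P.biUnion (Sum.elim As Bs) →
      #P = #(S.filter (IsBreak A)) := by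
    rintro P rfl
    refine card_bij (fun p _ => e p) ?_ ?_ ?_
    · intro p hp
      exact mem_filter.2 ⟨mem_biUnion.2 ⟨p, hp, hmem p⟩, ((he p).2 _ (hmem p)).2 rfl⟩
    · intro p _ q _ hpq
      exact h.eq_of_mem_piece (hmem p) (hpq ▸ hmem q)
    · intro x hx
      obtain ⟨hxS, hbr⟩ := mem_filter.1 hx
      obtain ⟨p, hp, hxp⟩ := mem_biUnion.1 hxS
      exact ⟨p, hp, (((he p).2 x hxp).1 hbr).symm⟩
  constructor
  · rintro ⟨P, hpar, hS⟩
    refine ⟨fun x hx => ?_, hcard P hS ▸ hpar⟩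
    obtain ⟨q, hq⟩ := h.exists_piece x
    rw [(he q).2 x hq]
    by_contra hne
    have hq' : x + 1 ∈ Sum.elim As Bs q := by
      rw [(he q).1] at hq ⊢
      exact succ_mem_cyclicIcc hq hne
    refine hx ?_
    rw [hS, mem_biUnion, mem_biUnion]
    constructor
    · rintro ⟨p, hp, hxp⟩
      exact ⟨p, hp, h.eq_of_mem_piece hxp hq ▸ hq'⟩
    · rintro ⟨p, hp, hxp⟩
      exact ⟨p, hp, h.eq_of_mem_piece hxp hq' ▸ hq⟩
  · rintro ⟨hbr, hpar⟩
    have hS : S = (univ.filter fun p => e p ∈ S).biUnion (Sum.elim As Bs) := by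
      have key : ∀ p, ∀ x ∈ Sum.elim As Bs p, (x ∈ S ↔ e p ∈ S) := by
        intro p x hx
        have hstep : ∀ y ∈ cyclicIcc (b p) (e p), y ≠ e p → (y ∈ S ↔ y + 1 ∈ S) := by
          intro y hy hne
          by_contra hc
          rw [← (he p).1] at hy
          exact hne (((he p).2 y hy).1 (hbr y hc))
        rw [(he p).1] at hx
        rw [← iff_of_mem_cyclicIcc (f := (· ∈ S)) hstep hx,
          ← iff_of_mem_cyclicIcc (f := (· ∈ S)) hstep (right_mem_cyclicIcc _ _)]
      ext x
      simp only [mem_biUnion, mem_filter, mem_univ, true_and]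
      constructor
      · intro hx
        obtain ⟨p, hp⟩ := h.exists_piece x
        exact ⟨p, (key p x hp).1 hx, hp⟩
      · rintro ⟨p, hp, hx⟩
        exact (key p x hx).2 hp
    exact ⟨_, (hcard _ hS).symm ▸ hpar, hS⟩

end IsCyclicDecomposition

theorem isBreak_compl {N : ℕ} (S : Finset (Fin (N + 1))) (x : Fin (N + 1)) :
    IsBreak Sᶜ x ↔ IsBreak S x := by
  simp only [IsBreak, mem_compl]
  tauto

theorem isBreak_Ioc {N : ℕ} {i j x : Fin (N + 1)} (hij : i < j) :
    IsBreak (Ioc i j) x ↔ x = i ∨ x = j := by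
  have hlt : ∀ y : Fin (N + 1), (y : ℕ) ≤ N := fun y => by omega
  have h1 : ((x + 1 : Fin (N + 1)) : ℕ) = if (x : ℕ) = N then 0 else (x : ℕ) + 1 := by
    rw [Fin.val_add_one]
    simp only [Fin.ext_iff, Fin.val_last]
  have h2 := hlt x
  have h3 := hlt j
  simp only [IsBreak, mem_Ioc, Fin.lt_def, Fin.le_def, h1, Fin.ext_iff] at *
  split_ifs <;> omega

open Classical in
theorem even_card_breaks_Ioc {N : ℕ} (A : Finset (Fin (N + 1))) {i j : Fin (N + 1)}
    (hij : i < j) :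
    (Even #((Ioc i j).filter (IsBreak A)) ↔ (i + 1 ∈ A ↔ j + 1 ∈ A)) ∧
      (Even #((Ioc i j)ᶜ.filter (IsBreak A)) ↔ (i + 1 ∈ A ↔ j + 1 ∈ A)) := by
  -- Mod 2, a break is a nonzero increment of the indicator, so the count telescopes on `Ioc i j`;
  -- the complement has the opposite sum, since the cyclic total is zero.
  let s : Fin (N + 1) → ZMod 2 := fun x => if x ∈ A then 1 else 0
  have hs : ∀ S : Finset (Fin (N + 1)),
      ((#(S.filter (IsBreak A)) : ℕ) : ZMod 2) = ∑ x ∈ S, (s (x + 1) - s x) := by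
    intro S
    rw [card_filter, Nat.cast_sum]
    refine sum_congr rfl fun x _ => ?_
    simp only [s, IsBreak]
    by_cases h1 : x ∈ A <;> by_cases h2 : x + 1 ∈ A <;> simp [h1, h2]
  have h1 := hs (Ioc i j)
  have h2 := hs (Ioc i j)ᶜ
  have h3 : ∑ x ∈ (Ioc i j)ᶜ, (s (x + 1) - s x) = -(s (j + 1) - s (i + 1)) := by
    rw [eq_neg_iff_add_eq_zero, ← sum_Ioc_cyclic_sub s hij.le, sum_compl_add_sum,
      sum_univ_cyclic_sub]
  rw [sum_Ioc_cyclic_sub s hij.le] at h1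
  rw [h3] at h2
  rw [← ZMod.natCast_eq_zero_iff_even, ← ZMod.natCast_eq_zero_iff_even, h1, h2]
  simp only [s]
  by_cases h1 : i + 1 ∈ A <;> by_cases h2 : j + 1 ∈ A <;> simp [h1, h2]

/-- The value of the resolution sign on a two-block noncrossing partition. -/
theorem resolutionSign_eq {N m : ℕ} {A : Finset (Fin (N + 1))}
    {As Bs : Fin m → Finset (Fin (N + 1))} (h : IsCyclicDecomposition A Aᶜ As Bs)
    {μ : SetPartition (N + 1)} {i j : Fin (N + 1)} (hij : i < j)
    (hμ : μ.parts = {Ioc i j, (Ioc i j)ᶜ}) (h1 : 2 ≤ #(Ioc i j)) (h2 : 2 ≤ #(Ioc i j)ᶜ) :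
    resolutionSign As Bs μ = -(Fermion.incr A i * Fermion.incr A j) := by
  classical
  obtain ⟨e1, e2⟩ := even_card_breaks_Ioc A hij
  have hall : ∀ par : ℕ → Prop, (∀ S ∈ μ.parts, IsUnionOfPieces As Bs par S) ↔
      (IsBreak A i ∧ IsBreak A j) ∧ par #((Ioc i j).filter (IsBreak A)) ∧
        par #((Ioc i j)ᶜ.filter (IsBreak A)) := by
    intro par
    have hb : (∀ x, IsBreak (Ioc i j) x → IsBreak A x) ↔ IsBreak A i ∧ IsBreak A j := by
      simp [isBreak_Ioc hij]
    simp only [hμ, mem_insert, mem_singleton, forall_eq_or_imp, forall_eq,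
      h.isUnionOfPieces_iff, isBreak_compl, hb]
    tauto
  unfold resolutionSign
  rw [if_neg (by
    rw [hμ]
    rintro ⟨S, hS, hlt⟩
    rcases mem_insert.1 hS with rfl | hS
    · omega
    · rw [mem_singleton.1 hS] at hlt; omega)]
  -- At a break `x` the increment is `1` or `-1` according to whether `x + 1 ∈ A`, so an even count
  -- means equal increments and coefficient `-1`.
  simp only [hall, ← Nat.not_even_iff_odd, e1, e2]
  simp only [IsBreak, Fermion.incr, Fermion.ind]
  by_cases c1 : i ∈ A <;> by_cases c2 : j ∈ A <;> by_cases c3 : i + 1 ∈ A <;>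
    by_cases c4 : j + 1 ∈ A <;> simp [c1, c2, c3, c4]

/-! ### Existence of the cyclic decomposition. -/

section Runs

variable {N : ℕ} (A : Finset (Fin (N + 1)))

theorem exists_isBreak {A : Finset (Fin (N + 1))} (hA : A.Nonempty) (hA' : Aᶜ.Nonempty) :
    ∃ x, IsBreak A x := by
  by_contra! hc
  have key : ∀ y, (0 ∈ A ↔ y ∈ A) := fun y =>
    iff_of_mem_cyclicIcc (u := 0) (v := Fin.last N) (f := (· ∈ A))
      (fun x _ _ => not_not.1 (hc x))
      (by rw [mem_cyclicIcc]; simp only [sub_zero, Fin.val_last]; omega)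
  obtain ⟨x, hx⟩ := hA
  obtain ⟨y, hy⟩ := hA'
  exact mem_compl.1 hy ((key y).1 ((key x).2 hx))

/-- A choice, for each `x`, of the first break at or after `x` in the cyclic order. -/
def IsRunEnd (e : Fin (N + 1) → Fin (N + 1)) : Prop :=
  ∀ x, IsBreak A (e x) ∧
    ∀ y, IsBreak A y → ((e x - x : Fin (N + 1)) : ℕ) ≤ ((y - x : Fin (N + 1)) : ℕ)

theorem exists_isRunEnd {A : Finset (Fin (N + 1))} (hA : A.Nonempty) (hA' : Aᶜ.Nonempty) :
    ∃ e, IsRunEnd A e := by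
  classical
  obtain ⟨z, hz⟩ := exists_isBreak hA hA'
  have : ∀ x, ∃ y, IsBreak A y ∧
      ∀ y', IsBreak A y' → ((y - x : Fin (N + 1)) : ℕ) ≤ ((y' - x : Fin (N + 1)) : ℕ) := by
    intro x
    obtain ⟨y, hy, hmin⟩ := exists_min_image (univ.filter (IsBreak A))
      (fun y => ((y - x : Fin (N + 1)) : ℕ)) ⟨z, by simpa using hz⟩
    exact ⟨y, (mem_filter.1 hy).2, fun y' hy' => hmin y' (by simpa using hy')⟩
  choose e he using this
  exact ⟨e, he⟩

namespace IsRunEnd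

variable {A} {e : Fin (N + 1) → Fin (N + 1)}

theorem not_isBreak (he : IsRunEnd A e) {x y : Fin (N + 1)} (hy : y ∈ cyclicIcc x (e x))
    (hne : y ≠ e x) : ¬ IsBreak A y := by
  intro hb
  rw [mem_cyclicIcc] at hy
  exact hne (sub_left_injective (Fin.ext (le_antisymm hy ((he x).2 y hb))))

theorem mem_iff (he : IsRunEnd A e) {x y : Fin (N + 1)} (hy : y ∈ cyclicIcc x (e x)) :
    x ∈ A ↔ y ∈ A :=
  iff_of_mem_cyclicIcc (f := (· ∈ A)) (fun _ hz hne => not_not.1 (he.not_isBreak hz hne)) hy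

theorem succ_mem_iff (he : IsRunEnd A e) (x : Fin (N + 1)) : e x + 1 ∈ A ↔ x ∉ A := by
  have h1 := he.mem_iff (right_mem_cyclicIcc x (e x))
  have h2 := (he x).1
  unfold IsBreak at h2
  tauto

theorem eq_of_mem (he : IsRunEnd A e) {x y z : Fin (N + 1)} (hx : IsBreak A (x - 1))
    (hy : IsBreak A (y - 1)) (hzx : z ∈ cyclicIcc x (e x)) (hzy : z ∈ cyclicIcc y (e y)) :
    x = y := by
  wlog hle : ((z - x : Fin (N + 1)) : ℕ) ≤ ((z - y : Fin (N + 1)) : ℕ) generalizing x y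
  · exact (this hy hx hzy hzx (le_of_not_ge hle)).symm
  by_contra hne
  have hxy : x ∈ cyclicIcc y (e y) := by
    rw [mem_cyclicIcc] at hzy ⊢
    rw [show x - y = (z - y) - (z - x) by abel, Fin.sub_val_of_le (by rwa [Fin.le_def])]
    omega
  obtain ⟨h1, h2, -⟩ := pred_mem_cyclicIcc hxy hne
  exact he.not_isBreak h1 h2 hx

/-- An interval inside `C` cannot step over a break. Only the breaks of `C` matter, so the lemma
serves both `A` and `Aᶜ`. -/
theorem maximal (he : IsRunEnd A e) {C : Finset (Fin (N + 1))}
    (hC : ∀ x, IsBreak C x ↔ IsBreak A x) {x : Fin (N + 1)} (hx : IsBreak A (x - 1))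
    (hsub : cyclicIcc x (e x) ⊆ C) :
    Maximal (fun I => IsCyclicInterval I ∧ I ⊆ C) (cyclicIcc x (e x)) := by
  refine ⟨⟨⟨_, _, rfl⟩, hsub⟩, ?_⟩
  rintro I ⟨⟨u, v, rfl⟩, hI⟩ hle
  have hf : ∀ z ∈ cyclicIcc u v, z ≠ v →
      (z ∈ cyclicIcc x (e x) ↔ z + 1 ∈ cyclicIcc x (e x)) := by
    intro z hz hzv
    have hnb : ¬ IsBreak A z := by
      rw [← hC]
      exact not_not.2 (iff_of_true (hI hz) (hI (succ_mem_cyclicIcc hz hzv)))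
    constructor
    · intro h
      refine succ_mem_cyclicIcc h ?_
      rintro rfl
      exact hnb (he x).1
    · intro h
      have hne : z + 1 ≠ x := by
        rintro rfl
        exact hnb (by simpa using hx)
      simpa using (pred_mem_cyclicIcc h hne).1
  intro y hy
  exact (iff_of_mem_cyclicIcc hf hy).1
    ((iff_of_mem_cyclicIcc hf (hle (left_mem_cyclicIcc _ _))).2 (left_mem_cyclicIcc _ _))

end IsRunEnd

theorem mem_of_succ_closed {U : Finset (Fin (N + 1))} (hU : U.Nonempty)
    (h : ∀ x ∈ U, x + 1 ∈ U) (y : Fin (N + 1)) : y ∈ U := by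
  obtain ⟨u, hu⟩ := hU
  obtain ⟨k, hk⟩ : ∃ k : ℕ, ((y - u : Fin (N + 1)) : ℕ) = k := ⟨_, rfl⟩
  induction k generalizing y with
  | zero => rwa [sub_eq_zero.1 (Fin.ext hk : y - u = 0)]
  | succ k ih =>
    have hyu : y ≠ u := by rintro rfl; simp at hk
    have := h _ (ih (y - 1) (by
      rw [show y - 1 - u = y - u - 1 by abel,
        Fin.val_sub_one_of_ne_zero (sub_ne_zero.2 hyu)]
      omega))
    simpa using this

theorem val_finRotate {m : ℕ} (i : Fin m) : (finRotate m i : ℕ) = (i + 1) % m := by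
  obtain _ | m := m
  · exact i.elim0
  · rw [coe_finRotate]
    split_ifs with h
    · simp [h]
    · have := i.2
      rw [Nat.mod_eq_of_lt]
      have : (i : ℕ) ≠ m := fun h' => h (Fin.ext h')
      omega

theorem exists_isCyclicDecomposition {A : Finset (Fin (N + 1))} (hA : A.Nonempty)
    (hA' : Aᶜ.Nonempty) :
    ∃ (m : ℕ) (As Bs : Fin m → Finset (Fin (N + 1))), IsCyclicDecomposition A Aᶜ As Bs := by
  obtain ⟨e, he⟩ := exists_isRunEnd hA hA'
  let St := {x : Fin (N + 1) // IsBreak A (x - 1)}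
  let nxt : St → St := fun x => ⟨e x.1 + 1, by simpa using (he x.1).1⟩
  have hnxt : Function.Injective nxt := by
    intro x y hxy
    have h1 : e x.1 = e y.1 := add_left_injective 1 (congrArg Subtype.val hxy)
    exact Subtype.ext (he.eq_of_mem x.2 y.2 (right_mem_cyclicIcc _ _)
      (h1 ▸ right_mem_cyclicIcc _ _))
  obtain ⟨a₀, ha₀⟩ : ∃ a₀ : St, a₀.1 ∈ A := by
    obtain ⟨y, hy⟩ := exists_isBreak hA hA'
    let s : St := ⟨y + 1, by simpa using hy⟩
    by_cases h : y + 1 ∈ A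
    · exact ⟨s, h⟩
    · exact ⟨nxt s, (he.succ_mem_iff _).2 h⟩
  -- `nxt` sends a run start to the next one and switches sides, so `σ` runs through starts in `A`.
  -- It is injective on a finite type, so `a₀` is periodic and its orbit numbers the pieces.
  let σ : St → St := nxt ∘ nxt
  have hper : a₀ ∈ Function.periodicPts σ := (hnxt.comp hnxt).mem_periodicPts a₀
  have hm := Function.minimalPeriod_pos_of_mem_periodicPts hper
  let a : Fin (Function.minimalPeriod σ a₀) → St := fun i => σ^[i] a₀
  have ha_inj : Function.Injective a := fun i j hij =>
    Fin.ext ((Function.iterate_eq_iterate_iff_of_lt_minimalPeriod i.2 j.2).1 hij)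
  have ha_succ : ∀ i, a (finRotate _ i) = σ (a i) := by
    intro i
    change σ^[(finRotate _ i : ℕ)] a₀ = σ (σ^[(i : ℕ)] a₀)
    rw [val_finRotate, Function.iterate_mod_minimalPeriod_eq, Function.iterate_succ_apply']
  have ha_mem : ∀ i, (a i).1 ∈ A := by
    intro i
    change (σ^[(i : ℕ)] a₀).1 ∈ A
    induction (i : ℕ) with
    | zero => exact ha₀
    | succ k ih =>
      rw [Function.iterate_succ_apply']
      exact (he.succ_mem_iff _).2 fun h => (he.succ_mem_iff _).1 h ih
  have hb_mem : ∀ i, (nxt (a i)).1 ∉ A := fun i h => (he.succ_mem_iff _).1 h (ha_mem i)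
  have hAsub : ∀ i, cyclicIcc (a i).1 (e (a i).1) ⊆ A := fun i x hx =>
    (he.mem_iff hx).1 (ha_mem i)
  have hBsub : ∀ i, cyclicIcc (nxt (a i)).1 (e (nxt (a i)).1) ⊆ Aᶜ := fun i x hx =>
    mem_compl.2 fun h => hb_mem i ((he.mem_iff hx).2 h)
  -- The orbit misses no run, because the union of its runs is nonempty and closed under successor.
  have hcover : ∀ x, x ∈ (univ.biUnion fun i => cyclicIcc (a i).1 (e (a i).1)) ∪
      univ.biUnion fun i => cyclicIcc (nxt (a i)).1 (e (nxt (a i)).1) := by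
    refine mem_of_succ_closed ⟨a₀.1, mem_union_left _ (mem_biUnion.2
      ⟨⟨0, hm⟩, mem_univ _, left_mem_cyclicIcc _ _⟩)⟩ fun x hx => ?_
    rcases mem_union.1 hx with hx | hx
    · obtain ⟨i, -, hi⟩ := mem_biUnion.1 hx
      by_cases hxe : x = e (a i).1
      · refine mem_union_right _ (mem_biUnion.2 ⟨i, mem_univ _, ?_⟩)
        rw [hxe]
        exact left_mem_cyclicIcc _ _
      · exact mem_union_left _ (mem_biUnion.2 ⟨i, mem_univ _, succ_mem_cyclicIcc hi hxe⟩)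
    · obtain ⟨i, -, hi⟩ := mem_biUnion.1 hx
      by_cases hxe : x = e (nxt (a i)).1
      · refine mem_union_left _ (mem_biUnion.2 ⟨finRotate _ i, mem_univ _, ?_⟩)
        rw [ha_succ, hxe]
        exact left_mem_cyclicIcc _ _
      · exact mem_union_right _ (mem_biUnion.2 ⟨i, mem_univ _, succ_mem_cyclicIcc hi hxe⟩)
  refine ⟨Function.minimalPeriod σ a₀, fun i => cyclicIcc (a i).1 (e (a i).1),
    fun i => cyclicIcc (nxt (a i)).1 (e (nxt (a i)).1), ?_⟩
  refine ⟨?_, ?_, ?_, ?_, ?_, ?_, ?_⟩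
  · exact fun i => he.maximal (fun _ => Iff.rfl) (a i).2 (hAsub i)
  · exact fun i => he.maximal (isBreak_compl A) (nxt (a i)).2 (hBsub i)
  · intro i j hij
    refine Finset.disjoint_left.2 fun x hx hx' => hij (ha_inj (Subtype.ext ?_))
    exact he.eq_of_mem (a i).2 (a j).2 hx hx'
  · intro i j hij
    refine Finset.disjoint_left.2 fun x hx hx' => hij (ha_inj (hnxt (Subtype.ext ?_)))
    exact he.eq_of_mem (nxt (a i)).2 (nxt (a j)).2 hx hx'
  · refine Subset.antisymm (biUnion_subset.2 fun i _ => hAsub i) fun x hx => ?_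
    refine (mem_union.1 (hcover x)).resolve_right fun h => ?_
    obtain ⟨i, -, hi⟩ := mem_biUnion.1 h
    exact mem_compl.1 (hBsub i hi) hx
  · refine Subset.antisymm (biUnion_subset.2 fun i _ => hBsub i) fun x hx => ?_
    refine (mem_union.1 (hcover x)).resolve_left fun h => ?_
    obtain ⟨i, -, hi⟩ := mem_biUnion.1 h
    exact mem_compl.1 hx (hAsub i hi)
  · refine ⟨fun i => (a i).1, fun i => e (a i).1, fun i => (nxt (a i)).1,
      fun i => e (nxt (a i)).1, fun _ => rfl, fun _ => rfl, fun i => ?_, fun i => ?_⟩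
    · rw [finRotate_apply]
    · exact (congrArg Subtype.val (ha_succ i)).trans (finRotate_apply _).symm

end Runs

/-! ### The expansion of the fermion and the conclusion. -/

theorem F_eq_sum_resolutionSign {N m : ℕ} {π : SetPartition (N + 1)} {A : Finset (Fin (N + 1))}
    (hπ : π.parts = {A, Aᶜ}) (hne : A ≠ Aᶜ) (hA : 2 ≤ #A) (hA' : 2 ≤ #Aᶜ)
    {As Bs : Fin m → Finset (Fin (N + 1))} (h : IsCyclicDecomposition A Aᶜ As Bs) :
    Fermion.F π = ∑ μ : NC (N + 1) with #μ.1.parts = 2,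
      resolutionSign As Bs μ.1 • Fermion.F μ.1 := by
  rw [Fermion.F_eq_of_parts_eq_pair hπ hne, Fermion.blockOp_eq_pairOp hA,
    Fermion.blockOp_eq_pairOp hA', Fermion.pairOp_mul_pairOp_compl_eq_sum, LinearMap.sum_apply]
  refine SetPartition.sum_two_block_noncrossing _ _ fun i j μ hij hμ => ?_
  have hne' : Ioc i j ≠ (Ioc i j)ᶜ := fun he => by
    have h1 : j ∈ Ioc i j := by simp [hij]
    have h2 := h1
    rw [he] at h2
    exact mem_compl.1 h2 h1
  -- On a singleton `blockOp` differs from `pairOp`, but there `pairOp` is zero, which matches the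
  -- sign `0`.
  have hsmall : (∃ S ∈ μ.1.parts, #S < 2) → resolutionSign As Bs μ.1 = 0 := fun h => if_pos h
  rw [LinearMap.smul_apply]
  by_cases h1 : 2 ≤ #(Ioc i j)
  · by_cases h2 : 2 ≤ #(Ioc i j)ᶜ
    · rw [resolutionSign_eq h hij hμ h1 h2, Fermion.F_eq_of_parts_eq_pair hμ hne',
        Fermion.blockOp_eq_pairOp h1, Fermion.blockOp_eq_pairOp h2]
    · rw [hsmall ⟨_, by rw [hμ]; simp, not_le.1 h2⟩, Fermion.pairOp_eq_zero (not_le.1 h2)]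
      simp
  · rw [hsmall ⟨_, by rw [hμ]; simp, not_le.1 h1⟩, Fermion.pairOp_eq_zero (not_le.1 h1)]
    simp

/-- Linear independence makes any expansion unique, so once one exists the default value is not
taken. -/
theorem resolutionCoeff_eq {n : ℕ} {π : SetPartition n} {c : NC n → ℂ}
    (h : Fermion.F π = ∑ μ : NC n, c μ • Fermion.F μ.1) : resolutionCoeff π = c := by
  have huniq : ∀ c' : NC n → ℂ, Fermion.F π = ∑ μ : NC n, c' μ • Fermion.F μ.1 → c' = c := by
    intro c' h'
    have h0 := Fintype.linearIndependent_iff.1 (linearIndependent_F_noncrossing n) (c' - c) (by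
      simp only [Pi.sub_apply, sub_smul, sum_sub_distrib]
      rw [← h, ← h', sub_self])
    ext μ
    exact sub_eq_zero.1 (h0 μ)
  have hex : ∃! c : NC n → ℂ, Fermion.F π = ∑ μ : NC n, c μ • Fermion.F μ.1 := ⟨c, h, huniq⟩
  unfold resolutionCoeff
  rw [dif_pos hex]
  exact huniq _ hex.choose_spec.1

theorem proposition6p2 (n : ℕ) (π : SetPartition n) (A B : Finset (Fin n))
    (hπ : π.parts = {A, B}) (hAB : A ≠ B) (hA : 2 ≤ #A) (hB : 2 ≤ #B) :
    (∃ (m : ℕ) (As Bs : Fin m → Finset (Fin n)), IsCyclicDecomposition A B As Bs) ∧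
    ∀ (m : ℕ) (As Bs : Fin m → Finset (Fin n)), IsCyclicDecomposition A B As Bs →
      crossingResolution n (Finsupp.single π 1) =
        ∑ μ : NC n with #μ.1.parts = 2,
          resolutionSign As Bs μ.1 • Finsupp.single μ (1 : ℂ) := by
  obtain rfl := SetPartition.eq_compl_of_parts_eq_pair hπ hAB
  obtain _ | N := n
  · exact absurd (card_le_univ A) (by rw [Fintype.card_fin]; omega)
  refine ⟨exists_isCyclicDecomposition (card_pos.1 (by omega)) (card_pos.1 (by omega)),
    fun m As Bs h => ?_⟩
  have hF := F_eq_sum_resolutionSign hπ hAB hA hB h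
  rw [sum_filter] at hF
  have hc := resolutionCoeff_eq (π := π)
    (c := fun μ => if #μ.1.parts = 2 then resolutionSign As Bs μ.1 else 0)
    (by rw [hF]; exact sum_congr rfl fun μ _ => by split_ifs <;> simp)
  rw [crossingResolution, Finsupp.linearCombination_single, one_smul, hc, sum_filter]
  refine sum_congr rfl fun μ _ => ?_
  by_cases hμ : #μ.1.parts = 2 <;> simp [hμ]
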